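/- **Setting.** Norms: $\|\cdot\|$ and $\|\cdot\|_\infty$ are the Euclidean and maximum norms of vectors and the induced norms of matrices; $\rho$ is the spectral radius. Let $\mathcal G$ be a connected undirected graph on the followers $\{1,\dots,N\}$ with weights $a_{ij}\ge 0$, $a_{ij}>0$ iff $i,j$ are adjacent; let $L_{\mathcal G}$ be its Laplacian matrix ($l_{ii}=\sum_j a_{ij}$, $l_{ij}=-a_{ij}$ for $i\neq j$), and let $D=\mathrm{diag}(a_{10},\dots,a_{N0})$ with $a_{i0}\ge 0$ the weights of the links from the leader. Let $A\in\mathbb R^{n\times n}$, $B\in\mathbb R^{n\times w}$, $K\in\mathbb R^{w\times n}$, and let $\Delta>0$ be the sampling period; below, $k$ stands for the time $k\Delta$. *DoS.* A finite or infinite sequence of DoS intervals $H_q=\{h_q\}\cup[h_q,h_q+\tau_q)$, $q=0,1,\dots$, is given, with $h_0\ge\Delta$, $\tau_q\ge0$, $h_{q+1}>h_q+\tau_q$. There are $\eta,\kappa\ge0$, $\tau_D>0$, $T>1$ such that for all $0<s\le t$ the number of $q$ with $h_q\in[s,t]$ is at most $\eta+(t-s)/\tau_D$, and the Lebesgue measure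 of $\bigcup_qH_q\cap[s,t]$ is at most $\kappa+(t-s)/T$. The transmission attempt at time $k\ge1$ fails if $k\Delta\in\bigcup_q H_q$ and succeeds otherwise. *Quantizer.* For $\sigma>0$ and an integer $R\ge1$, $q_R(\chi)=0$ for $-\sigma<\chi<\sigma$, $q_R(\chi)=2z\sigma$ for $(2z-1)\sigma\le\chi<(2z+1)\sigma$, $z=1,\dots,R$, $q_R(\chi)=2R\sigma$ for $\chi\ge(2R+1)\sigma$, and $q_R(\chi)=-q_R(-\chi)$ for $\chi\le-\sigma$; $Q_R$ applies $q_R$ to each coordinate. *Closed loop.* For $k\ge1$: $x_0(k)=Ax_0(k-1)$ (leader), and $x_i(k)=Ax_i(k-1)+Bu_i(k-1)$ (followers $i=1,\dots,N$), where $$u_i(k)=K\sum_{j=1}^Na_{ij}(\hat x_j(k)-\hat x_i(k))+Ka_{i0}(\hat x_0(k)-\hat x_i(k)).$$ For $j=0,1,\dots,N$ the estimates are given by $\hat x_j(0)=0$ and, for $k\ge 1$, $\hat x_j(k)=A\hat x_j(k-1)+\theta(k-1)Q_R\big(\frac{x_j(k)-A\hat x_j(k-1)}{\theta(k-1)}\big)$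 if the transmission at $k$ succeeds and $\hat x_j(k)=A\hat x_j(k-1)$ if it fails. The scaling parameter is given by $\theta(0)=\theta_0$, and $\theta(k)=\gamma_1\theta(k-1)$ if the transmission at $k$ succeeds, $\theta(k)=\gamma_2\theta(k-1)$ if it fails. The initial states satisfy $\|x_j(0)\|_\infty\le C_{x_0}$, $j=0,\dots,N$, with $C_{x_0}>0$. *Matrices and constants.* Let $\Pi=I_N\otimes A-(L_{\mathcal G}+D)\otimes BK$, $\Omega=I_N\otimes A+(L_{\mathcal G}+D)\otimes BK$, $\Sigma=(L_{\mathcal G}+D)\otimes BK$, $\Phi=D\otimes BK$, $$\widetilde A=\begin{bmatrix}\Pi&\Sigma&-\Phi\\-\Sigma&\Omega&-\Phi\\0&0&I_N\otimes A\end{bmatrix},$$ and let $\widetilde A_{ij}(m)$ be the blocks of $\widetilde A^m$. Assume $1/T+\Delta/\tau_D<1$ and put $$M=\Big\lfloor\frac{(\kappa+\eta\Delta)(1-1/T-\Delta/\tau_D)^{-1}}{\Delta}\Big\rfloor .$$ For $0\le m\le M$ let $P(m+1)=(\Pi\widetilde A_{11}(m)+\Sigma\widetilde A_{21}(m))/\gamma_2^m$,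 $S(m+1)=(\Pi\widetilde A_{12}(m)+\Sigma\widetilde A_{22}(m))/\gamma_2^m$, $Z(m+1)=(\Pi\widetilde A_{13}(m)+\Sigma\widetilde A_{23}(m)-\Phi(I_N\otimes A^m))/\gamma_2^m$, and $\widetilde P(m+1)=(\Psi\otimes I_n)^{*}P(m+1)(\Psi\otimes I_n)$, where $\Psi$ is a unitary matrix for which $\Psi^{-1}(L_{\mathcal G}+D)\Psi$ is upper triangular. Let $\tilde d_0$ and $\widetilde C_4\ge1$ satisfy $\rho(\widetilde P(1))<\tilde d_0<1$ and $\|\widetilde P(1)^k\|\le\widetilde C_4\tilde d_0^{\,k}$ for all $k\ge1$. Put $\tilde d=\tilde d_0/\gamma_1$, $\widetilde C_2=\max_{0\le m\le M}\|S(m+1)\|+\max_{0\le m\le M}\|Z(m+1)\|$, $$\widetilde C_3=\max\Big\{2\widetilde C_4\sqrt{Nn},\ \frac{\widetilde C_2\widetilde C_4\sqrt{Nn}}{(1-\tilde d)\gamma_1}\Big\},\qquad \tilde\zeta=\max\Big\{\max_{0\le m\le M}\|(\widetilde A/\gamma_2)^m\|,\ \max_{0\le m\le M}\|(A/\gamma_2)^m\|\Big\}.$$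 **Theorem 2.** In this setting suppose that $\tilde d_0<\gamma_1<1$, that $\gamma_2>0$ satisfies $\|\widetilde P(m+1)\|\le\rho(\widetilde P(1))/\widetilde C_4$ for $1\le m\le M$, that $\theta_0\ge C_{x_0}\gamma_1/\sigma$, and that $$2R+1\ \ge\ \tilde\zeta\,\big\|[-\Sigma\ \ \Omega\ \ -\Phi]\big\|_\infty\,\frac{\sqrt{\widetilde C_3^2+2Nn}}{\gamma_1}.$$ Then the following hold. (i) The quantizers of the leader and of the followers do not overflow: $\Big\|\frac{x_j(k)-A\hat x_j(k-1)}{\theta(k-1)}\Big\|_\infty\le(2R+1)\sigma$ for all $j=0,1,\dots,N$ and all $k\ge1$. (ii) If in addition $\frac1T+\frac\Delta{\tau_D}<\frac{-\ln\gamma_1}{\ln\gamma_2-\ln\gamma_1}$, then $\lim_{k\to\infty}\|x_i(k)-x_0(k)\|_\infty=0$ for $i=1,\dots,N$. -/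

import Mathlib

open Filter Topology MeasureTheory
open scoped Kronecker Matrix

noncomputable section

namespace LeaderFollower

/-! ### Induced matrix norms and the spectral radius -/

section norms

variable {m n : Type*} [Fintype m] [Fintype n]

open scoped Matrix.Norms.L2Operator in
/-- The norm of a real or complex matrix that is induced by the Euclidean norms. -/
def twoNorm {𝕜 : Type*} [RCLike 𝕜] [DecidableEq n] (X : Matrix m n 𝕜) : ℝ := ‖X‖

attribute [local instance] Matrix.linftyOpNormedAddCommGroup in
/-- The norm of a real matrix that is induced by the maximum norms (the largest absolute
row sum). -/
def infNorm (X : Matrix m n ℝ) : ℝ := ‖X‖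

/-- The spectral radius of a complex square matrix. -/
def specRad [DecidableEq n] (X : Matrix n n ℂ) : ℝ := (spectralRadius ℂ X).toReal

end norms

/-! ### The uniform quantizer -/

/-- The scalar uniform quantizer with `2 R + 1` levels and half step `σ`. -/
def quant (R : ℕ) (σ χ : ℝ) : ℝ :=
  if |χ| < σ then 0
  else SignType.sign χ * (2 * (min R ⌊(|χ| / σ + 1) / 2⌋₊ : ℕ) * σ)

theorem quant_zero (R : ℕ) (σ χ : ℝ) (h₁ : -σ < χ) (h₂ : χ < σ) : quant R σ χ = 0 := by
  simp [quant, abs_lt.2 ⟨h₁, h₂⟩]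

theorem quant_mid (R : ℕ) (σ χ : ℝ) (hσ : 0 < σ) (z : ℕ) (hz : 1 ≤ z) (hzR : z ≤ R)
    (h₁ : (2 * z - 1) * σ ≤ χ) (h₂ : χ < (2 * z + 1) * σ) : quant R σ χ = 2 * z * σ := by
  have hz' : (1 : ℝ) ≤ z := by exact_mod_cast hz
  have hχ : σ ≤ χ := by nlinarith
  have hpos : 0 < χ := hσ.trans_le hχ
  have hfl : ⌊(|χ| / σ + 1) / 2⌋₊ = z := by
    rw [abs_of_pos hpos, Nat.floor_eq_iff (by positivity)]
    have e₁ : 2 * (z : ℝ) - 1 ≤ χ / σ := (le_div_iff₀ hσ).2 h₁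
    have e₂ : χ / σ < 2 * (z : ℝ) + 1 := (div_lt_iff₀ hσ).2 h₂
    constructor <;> linarith
  rw [quant, if_neg (by rw [abs_of_pos hpos]; exact not_lt.2 hχ), hfl, sign_pos hpos,
    min_eq_right hzR]
  simp

theorem quant_sat (R : ℕ) (σ χ : ℝ) (hσ : 0 < σ) (h : (2 * R + 1) * σ ≤ χ) :
    quant R σ χ = 2 * R * σ := by
  have hR : (0 : ℝ) ≤ R := R.cast_nonneg
  have hχ : σ ≤ χ := by nlinarith
  have hpos : 0 < χ := hσ.trans_le hχ
  have hfl : R ≤ ⌊(|χ| / σ + 1) / 2⌋₊ := by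
    rw [abs_of_pos hpos, Nat.le_floor_iff (by positivity)]
    have e₁ : 2 * (R : ℝ) + 1 ≤ χ / σ := (le_div_iff₀ hσ).2 h
    linarith
  rw [quant, if_neg (by rw [abs_of_pos hpos]; exact not_lt.2 hχ), sign_pos hpos,
    min_eq_left hfl]
  simp

theorem quant_neg (R : ℕ) (σ χ : ℝ) : quant R σ χ = -quant R σ (-χ) := by
  by_cases h : |χ| < σ
  · simp [quant, h]
  · simp [quant, h, Left.sign_neg]

/-- The vector version of the quantizer, acting coordinatewise. -/
def quantVec {n : ℕ} (R : ℕ) (σ : ℝ) (v : Fin n → ℝ) : Fin n → ℝ := fun p => quant R σ (v p)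

/-! ### Denial-of-service attacks -/

/-- A DoS signal for the sampling period `Δ`. The `q`-th off/on transition is at time `h q`,
and the `q`-th DoS interval has length `τ q`; the indices are the `q < count`, so that there
may be infinitely many, finitely many or no DoS intervals. A DoS interval starts after the end
of the previous one. -/
structure DoS (Δ : ℝ) where
  count : ℕ∞
  h : ℕ → ℝ
  τ : ℕ → ℝ
  first : 0 < count → Δ ≤ h 0
  len_nonneg : ∀ q : ℕ, (q : ℕ∞) < count → 0 ≤ τ q
  separated : ∀ q : ℕ, ((q + 1 : ℕ) : ℕ∞) < count → h q + τ q < h (q + 1)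

namespace DoS

variable {Δ : ℝ} (S : DoS Δ)

/-- The `q`-th DoS interval `{h q} ∪ [h q, h q + τ q)`. -/
def interval (q : ℕ) : Set ℝ := {S.h q} ∪ Set.Ico (S.h q) (S.h q + S.τ q)

/-- The set of all times at which the network is under DoS. -/
def active : Set ℝ := {t | ∃ q : ℕ, (q : ℕ∞) < S.count ∧ t ∈ S.interval q}

/-- The indices of the off/on transitions that occur in `[s, t]`. -/
def transitions (s t : ℝ) : Set ℕ := {q | (q : ℕ∞) < S.count ∧ S.h q ∈ Set.Icc s t}

/-- DoS frequency: there are at most `η + (t - s) / τD` off/on transitions in `[s, t]`. -/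
def FrequencyBound (η τD : ℝ) : Prop :=
  ∀ s t : ℝ, 0 < s → s ≤ t →
    (S.transitions s t).Finite ∧ ((S.transitions s t).ncard : ℝ) ≤ η + (t - s) / τD

/-- DoS duration: the part of `[s, t]` under DoS has length at most `κ + (t - s) / T`. -/
def DurationBound (κ T : ℝ) : Prop :=
  ∀ s t : ℝ, 0 < s → s ≤ t →
    (volume (S.active ∩ Set.Icc s t)).toReal ≤ κ + (t - s) / T

/-- The transmission attempt at time `k Δ` fails. -/
def Fails (k : ℕ) : Prop := (k : ℝ) * Δ ∈ S.active

end DoS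

/-- The bound `M` on the number of consecutive failed transmissions. -/
def maxFail (Δ η τD κ T : ℝ) : ℕ :=
  ⌊(κ + η * Δ) * (1 - 1 / T - Δ / τD)⁻¹ / Δ⌋₊

/-! ### The multi-agent system -/

/-- The data of a leader-follower system with `N` followers, state dimension `n` and input
dimension `w`: the dynamics `A`, `B`, the feedback gain `K`, the weights `a i j` between the
followers and the weights `a0 i` of the links from the leader. -/
structure System (N n w : ℕ) where
  A : Matrix (Fin n) (Fin n) ℝ
  B : Matrix (Fin n) (Fin w) ℝ
  K : Matrix (Fin w) (Fin n) ℝ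
  a : Matrix (Fin N) (Fin N) ℝ
  a0 : Fin N → ℝ

namespace System

variable {N n w : ℕ} (P : System N n w)

/-- The weights belong to the undirected graph `G` among the followers; the weights of the
links from the leader are nonnegative. -/
structure HasGraph (G : SimpleGraph (Fin N)) : Prop where
  nonneg : ∀ i j, 0 ≤ P.a i j
  pos_iff : ∀ i j, 0 < P.a i j ↔ G.Adj i j
  leader_nonneg : ∀ i, 0 ≤ P.a0 i

/-- The control input of follower `i`, for the estimates `xh` of the states of the followers
and the estimate `xh0` of the state of the leader. -/
def input (xh : Fin N → Fin n → ℝ) (xh0 : Fin n → ℝ) (i : Fin N) : Fin w → ℝ :=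
  P.K *ᵥ (∑ j, P.a i j • (xh j - xh i)) + P.K *ᵥ (P.a0 i • (xh0 - xh i))

/-- The argument of the quantizer for an agent that has the state `x` at a time `k`, the
estimate `xh` at time `k - 1`, and the scaling parameter `θ` at time `k - 1`. -/
def quantArg (x xh : Fin n → ℝ) (θ : ℝ) : Fin n → ℝ := θ⁻¹ • (x - P.A *ᵥ xh)

/-- `x`, `x0` are the states of the followers and of the leader, `xh`, `xh0` their estimates,
and `θ` is the scaling parameter, for the closed loop with the quantizer given by `R`, `σ`, the
zooming factors `γ₁`, `γ₂`, and the DoS signal `S`; the argument `k` stands for the time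
`k Δ`. -/
structure IsTrajectory {Δ : ℝ} (S : DoS Δ) (R : ℕ) (σ γ₁ γ₂ θ₀ : ℝ)
    (x xh : ℕ → Fin N → Fin n → ℝ) (x0 xh0 : ℕ → Fin n → ℝ) (θ : ℕ → ℝ) : Prop where
  follower : ∀ k i, x (k + 1) i = P.A *ᵥ x k i + P.B *ᵥ P.input (xh k) (xh0 k) i
  leader : ∀ k, x0 (k + 1) = P.A *ᵥ x0 k
  est_init : ∀ i, xh 0 i = 0
  est_success : ∀ k i, ¬ S.Fails (k + 1) →
    xh (k + 1) i = P.A *ᵥ xh k i + θ k • quantVec R σ (P.quantArg (x (k + 1) i) (xh k i) (θ k))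
  est_fail : ∀ k i, S.Fails (k + 1) → xh (k + 1) i = P.A *ᵥ xh k i
  est0_init : xh0 0 = 0
  est0_success : ∀ k, ¬ S.Fails (k + 1) →
    xh0 (k + 1) = P.A *ᵥ xh0 k + θ k • quantVec R σ (P.quantArg (x0 (k + 1)) (xh0 k) (θ k))
  est0_fail : ∀ k, S.Fails (k + 1) → xh0 (k + 1) = P.A *ᵥ xh0 k
  scale_init : θ 0 = θ₀
  scale_success : ∀ k, ¬ S.Fails (k + 1) → θ (k + 1) = γ₁ * θ k
  scale_fail : ∀ k, S.Fails (k + 1) → θ (k + 1) = γ₂ * θ k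

/-- No quantizer, neither of a follower nor of the leader, is overflowed at any transmission
attempt. -/
def NoOverflow (R : ℕ) (σ : ℝ) (x xh : ℕ → Fin N → Fin n → ℝ) (x0 xh0 : ℕ → Fin n → ℝ)
    (θ : ℕ → ℝ) : Prop :=
  ∀ k : ℕ,
    (∀ i, ‖P.quantArg (x (k + 1) i) (xh k i) (θ k)‖ ≤ (2 * R + 1) * σ) ∧
    ‖P.quantArg (x0 (k + 1)) (xh0 k) (θ k)‖ ≤ (2 * R + 1) * σ

/-! ### The matrices and constants of the design -/

/-- The Laplacian matrix of the graph among the followers. -/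
def laplacian : Matrix (Fin N) (Fin N) ℝ :=
  Matrix.of fun i j => if i = j then ∑ l, P.a i l else -P.a i j

/-- `L_G + D`, with the diagonal matrix `D` of the weights of the links from the leader. -/
def LD : Matrix (Fin N) (Fin N) ℝ := P.laplacian + Matrix.diagonal P.a0

/-- `I_N ⊗ A`. -/
def IA : Matrix (Fin N × Fin n) (Fin N × Fin n) ℝ :=
  (1 : Matrix (Fin N) (Fin N) ℝ) ⊗ₖ P.A

/-- `Σ = (L_G + D) ⊗ B K`. -/
def Sig : Matrix (Fin N × Fin n) (Fin N × Fin n) ℝ := P.LD ⊗ₖ (P.B * P.K)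

/-- `Φ = D ⊗ B K`. -/
def Phi : Matrix (Fin N × Fin n) (Fin N × Fin n) ℝ := Matrix.diagonal P.a0 ⊗ₖ (P.B * P.K)

/-- `Π = I_N ⊗ A - (L_G + D) ⊗ B K`. -/
def Pim : Matrix (Fin N × Fin n) (Fin N × Fin n) ℝ := P.IA - P.LD ⊗ₖ (P.B * P.K)

/-- `Ω = I_N ⊗ A + (L_G + D) ⊗ B K`. -/
def Omg : Matrix (Fin N × Fin n) (Fin N × Fin n) ℝ := P.IA + P.LD ⊗ₖ (P.B * P.K)

/-- The row block matrix `[-Σ Ω -Φ]`. -/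
def outRow : Matrix (Fin N × Fin n)
    (((Fin N × Fin n) ⊕ (Fin N × Fin n)) ⊕ (Fin N × Fin n)) ℝ :=
  Matrix.fromCols (Matrix.fromCols (-P.Sig) P.Omg) (-P.Phi)

/-- The block matrix `Ã` with the rows `[Π Σ -Φ]`, `[-Σ Ω -Φ]` and `[0 0 I_N ⊗ A]`. -/
def At : Matrix (((Fin N × Fin n) ⊕ (Fin N × Fin n)) ⊕ (Fin N × Fin n))
    (((Fin N × Fin n) ⊕ (Fin N × Fin n)) ⊕ (Fin N × Fin n)) ℝ :=
  Matrix.fromBlocks (Matrix.fromBlocks P.Pim P.Sig (-P.Sig) P.Omg)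
    (Matrix.fromRows (-P.Phi) (-P.Phi)) 0 P.IA

/-- The block in position `(1, 1)` of `Ã ^ m`. -/
def At11 (m : ℕ) : Matrix (Fin N × Fin n) (Fin N × Fin n) ℝ :=
  (P.At ^ m).submatrix (Sum.inl ∘ Sum.inl) (Sum.inl ∘ Sum.inl)
/-- The block in position `(1, 2)` of `Ã ^ m`. -/
def At12 (m : ℕ) : Matrix (Fin N × Fin n) (Fin N × Fin n) ℝ :=
  (P.At ^ m).submatrix (Sum.inl ∘ Sum.inl) (Sum.inl ∘ Sum.inr)
/-- The block in position `(1, 3)` of `Ã ^ m`. -/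
def At13 (m : ℕ) : Matrix (Fin N × Fin n) (Fin N × Fin n) ℝ :=
  (P.At ^ m).submatrix (Sum.inl ∘ Sum.inl) Sum.inr
/-- The block in position `(2, 1)` of `Ã ^ m`. -/
def At21 (m : ℕ) : Matrix (Fin N × Fin n) (Fin N × Fin n) ℝ :=
  (P.At ^ m).submatrix (Sum.inl ∘ Sum.inr) (Sum.inl ∘ Sum.inl)
/-- The block in position `(2, 2)` of `Ã ^ m`. -/
def At22 (m : ℕ) : Matrix (Fin N × Fin n) (Fin N × Fin n) ℝ :=
  (P.At ^ m).submatrix (Sum.inl ∘ Sum.inr) (Sum.inl ∘ Sum.inr)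
/-- The block in position `(2, 3)` of `Ã ^ m`. -/
def At23 (m : ℕ) : Matrix (Fin N × Fin n) (Fin N × Fin n) ℝ :=
  (P.At ^ m).submatrix (Sum.inl ∘ Sum.inr) Sum.inr

/-- The matrix `P(m+1)`. -/
def Pmat (γ₂ : ℝ) (m : ℕ) : Matrix (Fin N × Fin n) (Fin N × Fin n) ℝ :=
  (γ₂ ^ m)⁻¹ • (P.Pim * P.At11 m + P.Sig * P.At21 m)

/-- The matrix `S(m+1)`. -/
def Smat (γ₂ : ℝ) (m : ℕ) : Matrix (Fin N × Fin n) (Fin N × Fin n) ℝ :=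
  (γ₂ ^ m)⁻¹ • (P.Pim * P.At12 m + P.Sig * P.At22 m)

/-- The matrix `Z(m+1)`. -/
def Zmat (γ₂ : ℝ) (m : ℕ) : Matrix (Fin N × Fin n) (Fin N × Fin n) ℝ :=
  (γ₂ ^ m)⁻¹ • (P.Pim * P.At13 m + P.Sig * P.At23 m
    - P.Phi * ((1 : Matrix (Fin N) (Fin N) ℝ) ⊗ₖ (P.A ^ m)))

/-- `Ψ` is unitary and `Ψ⁻¹ (L_G + D) Ψ` is upper triangular (so that its diagonal entries are
the eigenvalues of `L_G + D`). -/
def IsTriangularizer (Ψ : Matrix (Fin N) (Fin N) ℂ) : Prop :=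
  Ψ ∈ Matrix.unitaryGroup (Fin N) ℂ ∧
    (Ψ⁻¹ * P.LD.map Complex.ofReal * Ψ).BlockTriangular id

/-- The matrix `P̃(m+1) = (Ψ ⊗ I_n)ᴴ P(m+1) (Ψ ⊗ I_n)`; for a real `Ψ` the conjugate transpose
is the transpose. -/
def Pt (Ψ : Matrix (Fin N) (Fin N) ℂ) (γ₂ : ℝ) (m : ℕ) :
    Matrix (Fin N × Fin n) (Fin N × Fin n) ℂ :=
  (Ψ ⊗ₖ (1 : Matrix (Fin n) (Fin n) ℂ))ᴴ * (P.Pmat γ₂ m).map Complex.ofReal *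
    (Ψ ⊗ₖ (1 : Matrix (Fin n) (Fin n) ℂ))

/-- The maximum of `f 0`, ..., `f M`. -/
def maxUpTo (M : ℕ) (f : ℕ → ℝ) : ℝ := (Finset.range (M + 1)).sup' Finset.nonempty_range_add_one f

/-- The constant `C̃₂ = max ‖S(m+1)‖ + max ‖Z(m+1)‖`, with the maxima over `0 ≤ m ≤ M`. -/
def C2 (γ₂ : ℝ) (M : ℕ) : ℝ :=
  maxUpTo M (fun m => twoNorm (P.Smat γ₂ m)) + maxUpTo M (fun m => twoNorm (P.Zmat γ₂ m))

/-- The constant `C̃₃`, depending on the choice of the constants `d₀` and `C₄`. -/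
def C3 (γ₁ γ₂ : ℝ) (M : ℕ) (d₀ C₄ : ℝ) : ℝ :=
  max (2 * C₄ * √(N * n)) (P.C2 γ₂ M * C₄ * √(N * n) / ((1 - d₀ / γ₁) * γ₁))

/-- The constant `ζ̃`, the larger one of the maxima of `‖(Ã / γ₂) ^ m‖` and of `‖(A / γ₂) ^ m‖`
over `0 ≤ m ≤ M`. -/
def zeta (γ₂ : ℝ) (M : ℕ) : ℝ :=
  max (maxUpTo M fun m => twoNorm ((γ₂⁻¹ • P.At) ^ m))
    (maxUpTo M fun m => twoNorm ((γ₂⁻¹ • P.A) ^ m))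

/-- The choice of the parameters: `d₀` and `C₄` are constants of the geometric decay of the
powers of `P̃(1)`, the zooming-in factor satisfies `d₀ < γ₁ < 1`, and the zooming-out factor `γ₂`
makes the matrices `P̃(m+1)`, `1 ≤ m ≤ M`, small. -/
structure GoodParams (Ψ : Matrix (Fin N) (Fin N) ℂ) (M : ℕ) (d₀ C₄ γ₁ γ₂ : ℝ) : Prop where
  rad_lt : specRad (P.Pt Ψ γ₂ 0) < d₀
  d₀_lt_one : d₀ < 1
  one_le : 1 ≤ C₄
  decay : ∀ k : ℕ, 1 ≤ k → twoNorm (P.Pt Ψ γ₂ 0 ^ k) ≤ C₄ * d₀ ^ k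
  d₀_lt : d₀ < γ₁
  lt_one : γ₁ < 1
  γ₂_pos : 0 < γ₂
  small : ∀ m : ℕ, 1 ≤ m → m ≤ M → twoNorm (P.Pt Ψ γ₂ m) ≤ specRad (P.Pt Ψ γ₂ 0) / C₄

end System

end LeaderFollower

end

noncomputable section

namespace LeaderFollower

/-! ### Counting failed transmissions under DoS -/

namespace DoS

variable {Δ : ℝ} {S : DoS Δ}

/-! Let δ, e, f stack the disagreement with the leader, the followers' estimation errors and N
copies of the leader's error. A failed transmission applies `At` to (δ, e, f) and multiplies θ by
γ₂. A successful one without overflow resets every error coordinate to at most σ θ(k-1) = (σ/γ₁)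
θ(k).

The invariant (`Reset`), at time 0 and at each success s, is this error bound with c = (σ/γ₁) θ(s),
together with ‖P(1)^j δ‖ ≤ d₀^j C₃ c for all j. After m failures and one success the new
disagreement is γ₂^m (P(m+1) δ + S(m+1) e + Z(m+1) f). If m = 0, P(1) only shifts j and gains d₀
without paying the constant C₄; if m ≥ 1, smallness of P(m+1) absorbs C₄. The error terms contribute
at most C₄ C₂ √(Nn) c, and `C3_contraction` says that the sum stays below γ₁ C₃ c, which matches the
factor γ₁ γ₂^m gained by θ (`reset_succ`).

DoS allows at most M failures in a row (`consecutive_fails_le`), so ζ bounds the growth of the state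
relative to θ between resets. One row of `At` then bounds the quantizer arguments, so no overflow
and the invariant are proved together. The state is O(θ), and θ tends to 0 because the long-run
proportion of failures is at most 1/T + Δ/τD. -/

theorem le_of_mem_interval {q : ℕ} (hq : (q : ℕ∞) < S.count) {t : ℝ} (ht : t ∈ S.interval q) :
    S.h q ≤ t ∧ t ≤ S.h q + S.τ q := by
  have h0 := S.len_nonneg q hq
  rcases ht with ht | ht
  · rw [Set.mem_singleton_iff] at ht
    constructor <;> linarith
  · exact ⟨ht.1, ht.2.le⟩

theorem add_len_lt {p q : ℕ} (hpq : p < q) (hq : (q : ℕ∞) < S.count) :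
    S.h p + S.τ p < S.h q := by
  induction q, hpq using Nat.le_induction with
  | base => exact S.separated p hq
  | succ q hpq ih =>
    have hq' : (q : ℕ∞) < S.count := lt_of_le_of_lt (by exact_mod_cast Nat.le_succ q) hq
    have := ih hq'
    have := S.separated q hq
    have := S.len_nonneg q hq'
    linarith

theorem period_le_onset {q : ℕ} (hq : (q : ℕ∞) < S.count) : Δ ≤ S.h q := by
  have h0 : (0 : ℕ∞) < S.count := lt_of_le_of_lt (zero_le) hq
  have h1 := S.first h0
  rcases Nat.eq_zero_or_pos q with rfl | hpos
  · exact h1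
  · have := add_len_lt hpos hq
    have := S.len_nonneg 0 (by exact_mod_cast h0)
    linarith

/-- A failure at jΔ is charged the whole cell [jΔ, jΔ + Δ). Prolonging every DoS interval by Δ
covers these cells: the duration bound measures the intervals themselves, the frequency bound counts
the prolongations. -/
theorem volume_le_of_cover {η τD κ T : ℝ} (hΔ : 0 < Δ) (hfreq : S.FrequencyBound η τD)
    (hdur : S.DurationBound κ T) {s t : ℝ} (hs : 0 < s) (hst : s ≤ t) {C : Set ℝ}
    (hC : C ⊆ Set.Icc s (t + Δ))
    (hcov : ∀ u ∈ C, ∃ q ∈ S.transitions s t, u ∈ Set.Ico (S.h q) (S.h q + S.τ q + Δ)) :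
    (volume C).toReal ≤ κ + (t + Δ - s) / T + (η + (t - s) / τD) * Δ := by
  obtain ⟨hfin, hcard⟩ := hfreq s t hs hst
  have hd := hdur s (t + Δ) hs (by linarith)
  have hsub : C ⊆ (S.active ∩ Set.Icc s (t + Δ)) ∪
      ⋃ q ∈ hfin.toFinset, Set.Ico (S.h q + S.τ q) (S.h q + S.τ q + Δ) := by
    intro u hu
    obtain ⟨q, hq, hq1, hq2⟩ := hcov u hu
    by_cases hlt : u < S.h q + S.τ q
    · exact Or.inl ⟨⟨q, hq.1, Or.inr ⟨hq1, hlt⟩⟩, hC hu⟩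
    · refine Or.inr ?_
      simp only [Set.mem_iUnion]
      exact ⟨q, by simpa using hq, not_lt.1 hlt, hq2⟩
  have hfinite : volume (S.active ∩ Set.Icc s (t + Δ)) ≠ ⊤ :=
    ne_top_of_le_ne_top (by simp) (measure_mono Set.inter_subset_right)
  have hU : volume (⋃ q ∈ hfin.toFinset, Set.Ico (S.h q + S.τ q) (S.h q + S.τ q + Δ)) ≤
      ENNReal.ofReal ((S.transitions s t).ncard * Δ) := by
    refine (measure_biUnion_finset_le _ _).trans ?_
    simp only [Real.volume_Ico, add_sub_cancel_left, Finset.sum_const, nsmul_eq_mul]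
    rw [Set.ncard_eq_toFinset_card _ hfin, ENNReal.ofReal_mul (by positivity),
      ENNReal.ofReal_natCast]
  have hle := (measure_mono hsub).trans ((measure_union_le _ _).trans (add_le_add_right hU _))
  have h2 := ENNReal.toReal_mono (ENNReal.add_ne_top.2 ⟨hfinite, ENNReal.ofReal_ne_top⟩) hle
  rw [ENNReal.toReal_add hfinite ENNReal.ofReal_ne_top, ENNReal.toReal_ofReal (by positivity)] at h2
  have := mul_le_mul_of_nonneg_right hcard hΔ.le
  linarith

/-- Starting from a time that is not under attack, at most `maxFail` consecutive transmissions
fail. -/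
theorem consecutive_fails_le {η τD κ T : ℝ} (hΔ : 0 < Δ) (hτD : 0 < τD)
    (hfreq : S.FrequencyBound η τD)
    (hdur : S.DurationBound κ T) (hDoS : 1 / T + Δ / τD < 1) {k m : ℕ}
    (hk : k = 0 ∨ ¬ S.Fails k) (hm : ∀ j, 1 ≤ j → j ≤ m → S.Fails (k + j)) :
    m ≤ maxFail Δ η τD κ T := by
  rcases Nat.eq_zero_or_pos m with rfl | hmpos
  · exact Nat.zero_le _
  obtain ⟨q₀, hq₀, hmem⟩ := hm 1 le_rfl hmpos
  push_cast at hmem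
  obtain ⟨hle₀, hle₁⟩ := le_of_mem_interval hq₀ hmem
  have hm1 : (1 : ℝ) ≤ m := by exact_mod_cast hmpos
  have hkΔ : (k : ℝ) * Δ < S.h q₀ := by
    rcases hk with rfl | hk
    · have := period_le_onset hq₀
      push_cast
      linarith
    · by_contra! hcon
      refine hk ⟨q₀, hq₀, Or.inr ⟨hcon, ?_⟩⟩
      linarith
  have hs : 0 < S.h q₀ := hΔ.trans_le (period_le_onset hq₀)
  have hst : S.h q₀ ≤ (k + m) * Δ := by nlinarith
  -- The window starts at the onset `h q₀`, not at (k+1)Δ, so that `q₀` itself counts as a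
  -- transition; since `h q₀` ≤ (k+1)Δ, its length is still at least mΔ.
  have hvol := volume_le_of_cover (C := Set.Ico (S.h q₀) ((k + m) * Δ + Δ)) hΔ hfreq hdur hs hst
    Set.Ico_subset_Icc_self (by
      intro u hu
      by_cases hu1 : u < (k + 1) * Δ
      · exact ⟨q₀, ⟨hq₀, le_rfl, hst⟩, hu.1, by linarith⟩
      rw [not_lt] at hu1
      have hu0 : 0 ≤ u / Δ := div_nonneg (hs.le.trans hu.1) hΔ.le
      obtain ⟨hj1, hj2⟩ := (Nat.floor_eq_iff hu0).1 (rfl : ⌊u / Δ⌋₊ = ⌊u / Δ⌋₊)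
      generalize ⌊u / Δ⌋₊ = j at hj1 hj2
      rw [le_div_iff₀ hΔ] at hj1
      rw [div_lt_iff₀ hΔ] at hj2
      have hkj : k + 1 ≤ j := by
        apply Nat.le_of_lt_succ
        have : ((k + 1 : ℕ) : ℝ) < (j + 1 : ℕ) := by
          push_cast
          exact lt_of_mul_lt_mul_right (hu1.trans_lt hj2) hΔ.le
        exact_mod_cast this
      have hjk : j ≤ k + m := by
        apply Nat.le_of_lt_succ
        have : (j : ℝ) < (k + m + 1 : ℕ) := by
          push_cast
          refine lt_of_mul_lt_mul_right (hj1.trans_lt ?_) hΔ.le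
          linarith [hu.2]
        exact_mod_cast this
      obtain ⟨i, rfl⟩ := Nat.exists_eq_add_of_le (Nat.le_of_succ_le hkj)
      obtain ⟨q, hq, hmemq⟩ := hm i (by omega) (by omega)
      obtain ⟨hl, hr⟩ := le_of_mem_interval hq hmemq
      have hkjR : ((k + 1 : ℕ) : ℝ) ≤ (k + i : ℕ) := by exact_mod_cast hkj
      have hjkR : ((k + i : ℕ) : ℝ) ≤ (k + m : ℕ) := by exact_mod_cast hjk
      push_cast at hkjR hjkR hl hr hj1 hj2
      refine ⟨q, ⟨hq, ?_, ?_⟩, by linarith, by linarith⟩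
      · rcases lt_trichotomy q q₀ with hlt | rfl | hlt
        · have := add_len_lt hlt hq₀
          nlinarith
        · exact le_rfl
        · have := add_len_lt hlt hq
          have := S.len_nonneg q₀ hq₀
          linarith
      · nlinarith)
  rw [Real.volume_Ico, ENNReal.toReal_ofReal (by linarith)] at hvol
  set ℓ := (k + m) * Δ + Δ - S.h q₀ with hℓ
  have hpos : 0 < 1 - 1 / T - Δ / τD := by linarith
  -- The volume bound contains ℓ/T and Δ(ℓ - Δ)/τD; these are moved to the left, and Δ²/τD is
  -- dropped.
  have hmain : ℓ * (1 - 1 / T - Δ / τD) ≤ κ + η * Δ := by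
    have e1 : ((k + m) * Δ - S.h q₀) / τD * Δ = ℓ * (Δ / τD) - Δ * Δ / τD := by
      rw [hℓ]; ring
    have e2 : 0 ≤ Δ * Δ / τD := by positivity
    have e3 : ℓ / T = ℓ * (1 / T) := by ring
    nlinarith
  have hℓm : m * Δ ≤ ℓ := by rw [hℓ]; linarith
  unfold maxFail
  apply Nat.le_floor
  rw [le_div_iff₀ hΔ, ← div_eq_mul_inv, le_div_iff₀ hpos]
  exact (mul_le_mul_of_nonneg_right hℓm hpos.le).trans hmain

open scoped Classical in
/-- The number of failed transmissions up to time `k`. -/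
def failCount (S : DoS Δ) (k : ℕ) : ℕ := ((Finset.Icc 1 k).filter S.Fails).card

theorem failCount_succ_of_fails {k : ℕ} (h : S.Fails (k + 1)) :
    S.failCount (k + 1) = S.failCount k + 1 := by
  classical
  unfold failCount
  rw [← Finset.insert_Icc_right_eq_Icc_add_one (by omega), Finset.filter_insert, if_pos h,
    Finset.card_insert_of_notMem (by simp)]

theorem failCount_succ_of_not_fails {k : ℕ} (h : ¬ S.Fails (k + 1)) :
    S.failCount (k + 1) = S.failCount k := by
  classical
  unfold failCount
  rw [← Finset.insert_Icc_right_eq_Icc_add_one (by omega), Finset.filter_insert, if_neg h]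

theorem failCount_mul_le {η τD κ T : ℝ} (hΔ : 0 < Δ) (hτD : 0 < τD) (hfreq : S.FrequencyBound η τD)
    (hdur : S.DurationBound κ T) {k : ℕ} (hk : 1 ≤ k) :
    S.failCount k * Δ ≤ κ + η * Δ + k * Δ * (1 / T + Δ / τD) := by
  classical
  have hk1 : (1 : ℝ) ≤ k := by exact_mod_cast hk
  set F := (Finset.Icc 1 k).filter S.Fails with hF
  have hdisj : Set.PairwiseDisjoint (F : Set ℕ) fun j : ℕ => Set.Ico (j * Δ) (j * Δ + Δ) := by
    intro i _ j _ hij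
    rw [Function.onFun, Set.disjoint_left]
    intro u hu hv
    apply hij
    have h1 : (i : ℝ) < (j + 1 : ℕ) := by
      push_cast
      exact lt_of_mul_lt_mul_right (by linarith [hu.1, hv.2]) hΔ.le
    have h2 : (j : ℝ) < (i + 1 : ℕ) := by
      push_cast
      exact lt_of_mul_lt_mul_right (by linarith [hu.2, hv.1]) hΔ.le
    norm_cast at h1 h2
    omega
  have hvolC : volume (⋃ j ∈ F, Set.Ico ((j : ℝ) * Δ) (j * Δ + Δ)) =
      ENNReal.ofReal (S.failCount k * Δ) := by
    rw [measure_biUnion_finset hdisj fun _ _ => measurableSet_Ico]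
    simp only [Real.volume_Ico, add_sub_cancel_left, Finset.sum_const, nsmul_eq_mul]
    rw [ENNReal.ofReal_mul (by positivity), ENNReal.ofReal_natCast]
    rfl
  have hbound : ∀ j ∈ F, Δ ≤ (j : ℝ) * Δ ∧ (j : ℝ) * Δ ≤ k * Δ := by
    intro j hj
    simp only [hF, Finset.mem_filter, Finset.mem_Icc] at hj
    have h1 : (1 : ℝ) ≤ j := by exact_mod_cast hj.1.1
    have h2 : (j : ℝ) ≤ k := by exact_mod_cast hj.1.2
    constructor <;> nlinarith
  -- The window starts at Δ because the DoS bounds need a positive left end and no onset precedes Δ.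
  have hvol := volume_le_of_cover (s := Δ) (t := k * Δ)
    (C := ⋃ j ∈ F, Set.Ico ((j : ℝ) * Δ) (j * Δ + Δ)) hΔ hfreq hdur hΔ (by nlinarith) (by
      simp only [Set.iUnion_subset_iff]
      intro j hj u hu
      obtain ⟨h1, h2⟩ := hbound j hj
      exact ⟨h1.trans hu.1, by linarith [hu.2]⟩) (by
      intro u hu
      simp only [Set.mem_iUnion] at hu
      obtain ⟨j, hj, hu⟩ := hu
      obtain ⟨h1, h2⟩ := hbound j hj
      obtain ⟨q, hq, hmem⟩ := (Finset.mem_filter.1 hj).2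
      obtain ⟨hl, hr⟩ := le_of_mem_interval hq hmem
      exact ⟨q, ⟨hq, period_le_onset hq, hl.trans h2⟩, hl.trans hu.1, by linarith [hu.2]⟩)
  rw [hvolC, ENNReal.toReal_ofReal (by positivity)] at hvol
  have e1 : κ + (k * Δ + Δ - Δ) / T + (η + (k * Δ - Δ) / τD) * Δ =
    κ + η * Δ + k * Δ * (1 / T + Δ / τD) - Δ * Δ / τD := by ring
  have e2 : 0 ≤ Δ * Δ / τD := by positivity
  linarith

end DoS

/-! ### Euclidean norms and decay under matrix powers -/

section euclidean

variable {m n : Type*} [Fintype m] [Fintype n]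

/-- The Euclidean norm of a vector. -/
def euc {𝕜 : Type*} [RCLike 𝕜] (v : m → 𝕜) : ℝ := ‖WithLp.toLp 2 v‖

theorem euc_nonneg (v : m → ℝ) : 0 ≤ euc v := norm_nonneg _

theorem euc_add_le (v u : m → ℝ) : euc (v + u) ≤ euc v + euc u := by
  unfold euc
  rw [WithLp.toLp_add]
  exact norm_add_le _ _

theorem euc_smul {c : ℝ} (hc : 0 ≤ c) (v : m → ℝ) : euc (c • v) = c * euc v := by
  unfold euc
  rw [WithLp.toLp_smul, norm_smul, Real.norm_of_nonneg hc]

theorem euc_sq (v : m → ℝ) : euc v ^ 2 = ∑ i, v i ^ 2 := by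
  simp [euc, EuclideanSpace.real_norm_sq_eq]

theorem euc_ofReal (v : m → ℝ) : euc (fun i => (v i : ℂ)) = euc v := by
  simp [euc, EuclideanSpace.norm_eq]

theorem norm_le_euc (v : m → ℝ) : ‖v‖ ≤ euc v := by
  refine (pi_norm_le_iff_of_nonneg (euc_nonneg v)).2 fun i => ?_
  exact PiLp.norm_apply_le (WithLp.toLp 2 v) i

theorem euc_le_sqrt_card_mul {v : m → ℝ} {c : ℝ} (hc : 0 ≤ c) (hv : ∀ i, |v i| ≤ c) :
    euc v ≤ √(Fintype.card m) * c := by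
  refine le_of_sq_le_sq ?_ (by positivity)
  rw [euc_sq, mul_pow, Real.sq_sqrt (by positivity), ← nsmul_eq_mul, ← Finset.card_univ,
    ← Finset.sum_const]
  exact Finset.sum_le_sum fun i _ => sq_le_sq' (abs_le.1 (hv i)).1 (abs_le.1 (hv i)).2

theorem euc_elim_sq (v : m → ℝ) (u : n → ℝ) : euc (Sum.elim v u) ^ 2 = euc v ^ 2 + euc u ^ 2 := by
  simp [euc_sq]

open scoped Matrix.Norms.L2Operator in
theorem euc_mulVec_le {𝕜 : Type*} [RCLike 𝕜] [DecidableEq n] (X : Matrix m n 𝕜) (v : n → 𝕜) :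
    euc (X *ᵥ v) ≤ twoNorm X * euc v :=
  Matrix.l2_opNorm_mulVec X (WithLp.toLp 2 v)

open scoped Matrix.Norms.L2Operator in
theorem twoNorm_nonneg {𝕜 : Type*} [RCLike 𝕜] [DecidableEq n] (X : Matrix m n 𝕜) :
    0 ≤ twoNorm X := norm_nonneg X

open scoped Matrix.Norms.L2Operator in
theorem twoNorm_le_of_euc_le [DecidableEq n] {X : Matrix m n ℝ} {c : ℝ} (hc : 0 ≤ c)
    (h : ∀ v, euc (X *ᵥ v) ≤ c * euc v) : twoNorm X ≤ c := by
  unfold twoNorm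
  rw [Matrix.l2_opNorm_def]
  refine ContinuousLinearMap.opNorm_le_bound _ hc fun v => ?_
  exact h (WithLp.ofLp v)

/-- Real vectors embed isometrically into complex ones. This brings bounds on the complex matrices
P̃ back to the real matrices P. -/
theorem twoNorm_le_twoNorm_ofReal [DecidableEq n] (X : Matrix m n ℝ) :
    twoNorm X ≤ twoNorm (X.map Complex.ofReal) := by
  refine twoNorm_le_of_euc_le (twoNorm_nonneg _) fun v => ?_
  have h := euc_mulVec_le (X.map Complex.ofReal) (fun i => (v i : ℂ))
  rw [euc_ofReal] at h
  convert h using 1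
  rw [← euc_ofReal]
  congr 1
  ext i
  simp [Matrix.mulVec, dotProduct]

open scoped Matrix.Norms.L2Operator in
theorem twoNorm_unitary_conj [DecidableEq n] {U : Matrix n n ℂ} (hU : U ∈ Matrix.unitaryGroup n ℂ)
    (X : Matrix n n ℂ) : twoNorm (Uᴴ * X * U) = twoNorm X := by
  unfold twoNorm
  have h := CStarRing.norm_mul_coe_unitary (Uᴴ * X) ⟨U, hU⟩
  have h' := CStarRing.norm_coe_unitary_mul (star ⟨U, hU⟩ : unitary (Matrix n n ℂ)) X
  exact h.trans h'

theorem unitary_conj_pow [DecidableEq n] {U : Matrix n n ℂ} (hU : U ∈ Matrix.unitaryGroup n ℂ)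
    (X : Matrix n n ℂ) (k : ℕ) : (Uᴴ * X * U) ^ k = Uᴴ * X ^ k * U := by
  have h1 : Uᴴ * U = 1 := Matrix.mem_unitaryGroup_iff'.1 hU
  have h2 : U * Uᴴ = 1 := Matrix.mem_unitaryGroup_iff.1 hU
  induction k with
  | zero => simp [h1]
  | succ k ih =>
    rw [pow_succ, ih, pow_succ]
    calc Uᴴ * X ^ k * U * (Uᴴ * X * U) = Uᴴ * X ^ k * (U * Uᴴ) * X * U := by
          simp only [Matrix.mul_assoc]
      _ = Uᴴ * (X ^ k * X) * U := by rw [h2, Matrix.mul_one]; simp only [Matrix.mul_assoc]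

theorem norm_mulVec_le_infNorm (X : Matrix m n ℝ) (v : n → ℝ) : ‖X *ᵥ v‖ ≤ infNorm X * ‖v‖ :=
  Matrix.linfty_opNorm_mulVec X v

theorem infNorm_nonneg (X : Matrix m n ℝ) : 0 ≤ infNorm X := by
  let _ : NormedAddCommGroup (Matrix m n ℝ) := Matrix.linftyOpNormedAddCommGroup
  exact norm_nonneg X

/-- The powers of `X` applied to `v` decay at least as fast as `d ^ j * c`. -/
def DecayBound [DecidableEq n] (X : Matrix n n ℝ) (d c : ℝ) (v : n → ℝ) : Prop :=
  ∀ j : ℕ, euc ((X ^ j) *ᵥ v) ≤ d ^ j * c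

namespace DecayBound

variable [DecidableEq n] {X : Matrix n n ℝ} {d c c' : ℝ} {v u : n → ℝ}

theorem euc_le (h : DecayBound X d c v) : euc v ≤ c := by simpa using h 0

/-- Applying `X` shifts the exponent by one, so the factor `d` is gained with no constant in front.
A bound on the norm of `v` alone would cost C₄ at each step. -/
theorem mulVec (h : DecayBound X d c v) : DecayBound X d (d * c) (X *ᵥ v) := fun j => by
  rw [Matrix.mulVec_mulVec, ← pow_succ]
  exact (h (j + 1)).trans_eq (by ring)

theorem add (h : DecayBound X d c v) (h' : DecayBound X d c' u) :
    DecayBound X d (c + c') (v + u) := fun j => by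
  rw [Matrix.mulVec_add]
  exact (euc_add_le _ _).trans ((add_le_add (h j) (h' j)).trans_eq (by ring))

theorem smul {a : ℝ} (ha : 0 ≤ a) (h : DecayBound X d c v) :
    DecayBound X d (a * c) (a • v) := fun j => by
  rw [Matrix.mulVec_smul, euc_smul ha]
  exact (mul_le_mul_of_nonneg_left (h j) ha).trans_eq (by ring)

theorem mono (hd : 0 ≤ d) (h : DecayBound X d c v) (hc : c ≤ c') : DecayBound X d c' v :=
  fun j => (h j).trans (mul_le_mul_of_nonneg_left hc (pow_nonneg hd j))

theorem of_euc_le {C : ℝ} (hd : 0 ≤ d) (hC : 0 ≤ C) (hX : ∀ j, twoNorm (X ^ j) ≤ C * d ^ j)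
    (hv : euc v ≤ c) : DecayBound X d (C * c) v := fun j =>
  (euc_mulVec_le _ _).trans ((mul_le_mul (hX j) hv (euc_nonneg _) (by positivity)).trans_eq
    (by ring))

end DecayBound

end euclidean

/-! ### Quantization error -/

theorem abs_sub_quant_le {R : ℕ} {σ χ : ℝ} (hσ : 0 < σ) (h : |χ| ≤ (2 * R + 1) * σ) :
    |χ - quant R σ χ| ≤ σ := by
  wlog hχ : 0 ≤ χ generalizing χ
  · have := this (χ := -χ) (by rwa [abs_neg]) (by linarith)
    rw [quant_neg, sub_neg_eq_add]
    rwa [← abs_neg, neg_sub, sub_neg_eq_add, add_comm] at this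
  rw [abs_of_nonneg hχ] at h
  rcases lt_or_ge χ σ with hlt | hge
  · rw [quant_zero R σ χ (by linarith) hlt, sub_zero, abs_of_nonneg hχ]
    exact hlt.le
  rcases h.lt_or_eq with hlt | heq
  · have hpos : 0 ≤ (χ / σ + 1) / 2 := by positivity
    obtain ⟨hz1, hz2⟩ := (Nat.floor_eq_iff hpos).1 (rfl : ⌊(χ / σ + 1) / 2⌋₊ = ⌊(χ / σ + 1) / 2⌋₊)
    have h1 : 1 ≤ ⌊(χ / σ + 1) / 2⌋₊ := by
      rw [Nat.one_le_floor_iff]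
      have := (one_le_div hσ).2 hge
      linarith
    generalize ⌊(χ / σ + 1) / 2⌋₊ = z at hz1 hz2 h1
    have e1 : (2 * z - 1) * σ ≤ χ := (le_div_iff₀ hσ).1 (by linarith)
    have e2 : χ < (2 * z + 1) * σ := (div_lt_iff₀ hσ).1 (by linarith)
    have hzR : z ≤ R := by
      apply Nat.le_of_lt_succ
      have : (z : ℝ) < (R + 1 : ℕ) := by
        push_cast
        have := lt_of_mul_lt_mul_right (e1.trans_lt hlt) hσ.le
        linarith
      exact_mod_cast this
    rw [quant_mid R σ χ hσ z h1 hzR e1 e2, abs_le]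
    constructor <;> linarith
  -- The endpoint (2R+1)σ is already saturated, but the error there is exactly σ.
  · rw [quant_sat R σ χ hσ heq.ge, heq]
    rw [show (2 * R + 1) * σ - 2 * R * σ = σ by ring, abs_of_pos hσ]

theorem System.le_maxUpTo {M m : ℕ} (hm : m ≤ M) (f : ℕ → ℝ) : f m ≤ System.maxUpTo M f :=
  Finset.le_sup' f (by simpa using Nat.lt_succ_of_le hm)

/-! ### Block matrices and the stacked system -/

namespace System

variable {N n w : ℕ} {P : System N n w}

/-- The vector of `N` copies of `v`. -/
def rep (N : ℕ) (v : Fin n → ℝ) : Fin N × Fin n → ℝ := fun p => v p.2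

/-- The stacked differences between the rows of `y` and of `y'`. -/
def stackSub (y y' : Fin N → Fin n → ℝ) : Fin N × Fin n → ℝ := fun p => y p.1 p.2 - y' p.1 p.2

theorem kronecker_mulVec_apply (L : Matrix (Fin N) (Fin N) ℝ) (X : Matrix (Fin n) (Fin n) ℝ)
    (v : Fin N × Fin n → ℝ) (p : Fin N × Fin n) :
    ((L ⊗ₖ X) *ᵥ v) p = ∑ j, L p.1 j * (X *ᵥ fun q => v (j, q)) p.2 := by
  simp only [Matrix.mulVec, dotProduct, Matrix.kroneckerMap_apply, Fintype.sum_prod_type,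
    Finset.mul_sum, mul_assoc]

theorem one_kronecker_mulVec_apply (X : Matrix (Fin n) (Fin n) ℝ)
    (v : Fin N × Fin n → ℝ) (p : Fin N × Fin n) :
    (((1 : Matrix (Fin N) (Fin N) ℝ) ⊗ₖ X) *ᵥ v) p = (X *ᵥ fun q => v (p.1, q)) p.2 := by
  rw [kronecker_mulVec_apply]
  simp [Matrix.one_apply]

theorem one_kronecker_mulVec_rep (X : Matrix (Fin n) (Fin n) ℝ) (v : Fin n → ℝ) :
    ((1 : Matrix (Fin N) (Fin N) ℝ) ⊗ₖ X) *ᵥ rep N v = rep N (X *ᵥ v) := by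
  ext p
  exact one_kronecker_mulVec_apply X _ p

section graph

variable {G : SimpleGraph (Fin N)}

theorem HasGraph.diag_eq_zero (hP : P.HasGraph G) (i : Fin N) : P.a i i = 0 :=
  le_antisymm (not_lt.1 fun h => G.irrefl ((hP.pos_iff i i).1 h)) (hP.nonneg i i)

theorem HasGraph.LD_apply (hP : P.HasGraph G) (i j : Fin N) :
    P.LD i j = (if i = j then ∑ l, P.a i l + P.a0 i else 0) - P.a i j := by
  by_cases h : i = j
  · subst h
    simp [LD, laplacian, hP.diag_eq_zero]
  · simp [LD, laplacian, h]

theorem HasGraph.sum_LD_mul (hP : P.HasGraph G) (i : Fin N) (y : Fin N → ℝ) :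
    ∑ j, P.LD i j * y j = P.a0 i * y i - ∑ j, P.a i j * (y j - y i) := by
  simp only [hP.LD_apply, sub_mul, ite_mul, zero_mul, Finset.sum_sub_distrib, Finset.sum_ite_eq,
    Finset.mem_univ, if_true, mul_sub, add_mul, Finset.sum_mul]
  ring

/-- The rows of the Laplacian sum to zero, so L + D and D act alike on copies of one vector. -/
theorem HasGraph.Sig_mulVec_rep (hP : P.HasGraph G) (v : Fin n → ℝ) :
    P.Sig *ᵥ rep N v = P.Phi *ᵥ rep N v := by
  ext p
  have h := hP.sum_LD_mul p.1 fun _ => ((P.B * P.K) *ᵥ v) p.2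
  simp only [sub_self, mul_zero, Finset.sum_const_zero, sub_zero] at h
  rw [Sig, Phi, kronecker_mulVec_apply, kronecker_mulVec_apply]
  refine h.trans ?_
  simp [Matrix.diagonal_apply, rep]

theorem HasGraph.B_mulVec_input (hP : P.HasGraph G) (xh : Fin N → Fin n → ℝ) (xh0 : Fin n → ℝ)
    (p : Fin N × Fin n) :
    (P.B *ᵥ P.input xh xh0 p.1) p.2 = -(P.Sig *ᵥ stackSub xh fun _ => xh0) p := by
  -- Subtracting `xh0` from every estimate leaves the differences unchanged, and the leader term
  -- supplies the D part of L + D.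
  have hw : ∑ j, P.a p.1 j • (xh j - xh p.1) + P.a0 p.1 • (xh0 - xh p.1) =
      -∑ j, P.LD p.1 j • (xh j - xh0) := by
    ext q
    simp only [Pi.add_apply, Finset.sum_apply, Pi.smul_apply, Pi.sub_apply, smul_eq_mul,
      Pi.neg_apply]
    rw [hP.sum_LD_mul p.1 fun j => xh j q - xh0 q]
    simp only [sub_sub_sub_cancel_right]
    ring
  rw [input, ← Matrix.mulVec_add, hw, Matrix.mulVec_mulVec, Matrix.mulVec_neg, Matrix.mulVec_sum,
    Sig, kronecker_mulVec_apply]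
  simp only [Matrix.mulVec_smul, Pi.neg_apply, Finset.sum_apply, Pi.smul_apply, smul_eq_mul]
  rfl

end graph

/-- The stacked state of the closed loop. -/
def stack (d e f : Fin N × Fin n → ℝ) :
    ((Fin N × Fin n) ⊕ (Fin N × Fin n)) ⊕ (Fin N × Fin n) → ℝ :=
  Sum.elim (Sum.elim d e) f

theorem outRow_mulVec_stack (d e f : Fin N × Fin n → ℝ) :
    P.outRow *ᵥ stack d e f = -(P.Sig *ᵥ d) + P.Omg *ᵥ e - P.Phi *ᵥ f := by
  rw [outRow, stack, Matrix.fromCols_mulVec, Sum.elim_comp_inl, Sum.elim_comp_inr,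
    Matrix.fromCols_mulVec, Sum.elim_comp_inl, Sum.elim_comp_inr, Matrix.neg_mulVec,
    Matrix.neg_mulVec, ← sub_eq_add_neg]

theorem At_mulVec_stack (d e f : Fin N × Fin n → ℝ) :
    P.At *ᵥ stack d e f = stack (P.Pim *ᵥ d + P.Sig *ᵥ e - P.Phi *ᵥ f)
      (-(P.Sig *ᵥ d) + P.Omg *ᵥ e - P.Phi *ᵥ f) (P.IA *ᵥ f) := by
  rw [At, stack, Matrix.fromBlocks_mulVec, Sum.elim_comp_inl, Sum.elim_comp_inr,
    Matrix.fromBlocks_mulVec, Sum.elim_comp_inl, Sum.elim_comp_inr, Matrix.fromRows_mulVec,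
    Matrix.zero_mulVec, zero_add, stack]
  congr 1
  ext (p | p) <;> simp [Matrix.neg_mulVec, sub_eq_add_neg]

theorem At_pow_mulVec_stack_fst (m : ℕ) (d e f : Fin N × Fin n → ℝ) :
    (fun p => ((P.At ^ m) *ᵥ stack d e f) (Sum.inl (Sum.inl p))) =
      P.At11 m *ᵥ d + P.At12 m *ᵥ e + P.At13 m *ᵥ f := by
  ext p
  simp [Matrix.mulVec, dotProduct, stack, At11, At12, At13, Fintype.sum_sum_type]

theorem At_pow_mulVec_stack_snd (m : ℕ) (d e f : Fin N × Fin n → ℝ) :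
    (fun p => ((P.At ^ m) *ᵥ stack d e f) (Sum.inl (Sum.inr p))) =
      P.At21 m *ᵥ d + P.At22 m *ᵥ e + P.At23 m *ᵥ f := by
  ext p
  simp [Matrix.mulVec, dotProduct, stack, At21, At22, At23, Fintype.sum_sum_type]

/-- `m` steps of `Ã` followed by the disagreement dynamics, in terms of the matrices of the
design. -/
theorem disagreement_after {γ₂ : ℝ} (hγ₂ : 0 < γ₂) (m : ℕ) {d e f d' e' f' : Fin N × Fin n → ℝ}
    (h : stack d' e' f' = (P.At ^ m) *ᵥ stack d e f)
    (hf : f' = ((1 : Matrix (Fin N) (Fin N) ℝ) ⊗ₖ (P.A ^ m)) *ᵥ f) :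
    P.Pim *ᵥ d' + P.Sig *ᵥ e' - P.Phi *ᵥ f' =
      γ₂ ^ m • (P.Pmat γ₂ m *ᵥ d + (P.Smat γ₂ m *ᵥ e + P.Zmat γ₂ m *ᵥ f)) := by
  have hd : d' = P.At11 m *ᵥ d + P.At12 m *ᵥ e + P.At13 m *ᵥ f := by
    rw [← At_pow_mulVec_stack_fst, ← h]; rfl
  have he : e' = P.At21 m *ᵥ d + P.At22 m *ᵥ e + P.At23 m *ᵥ f := by
    rw [← At_pow_mulVec_stack_snd, ← h]; rfl
  have hne : γ₂ ^ m ≠ 0 := (pow_pos hγ₂ m).ne'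
  rw [hd, he, hf]
  simp only [Pmat, Smat, Zmat, Matrix.smul_mulVec, smul_add, smul_smul, mul_inv_cancel₀ hne,
    one_smul, Matrix.add_mulVec, Matrix.sub_mulVec, Matrix.mulVec_add, Matrix.mulVec_mulVec,
    smul_sub]
  abel

theorem euc_At_pow_mulVec_le {γ₂ : ℝ} (hγ₂ : 0 < γ₂) {M m : ℕ} (hm : m ≤ M)
    (v : ((Fin N × Fin n) ⊕ (Fin N × Fin n)) ⊕ (Fin N × Fin n) → ℝ) :
    euc ((P.At ^ m) *ᵥ v) ≤ γ₂ ^ m * (P.zeta γ₂ M * euc v) := by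
  have hne : γ₂ ^ m ≠ 0 := (pow_pos hγ₂ m).ne'
  have h : (P.At ^ m) *ᵥ v = γ₂ ^ m • (((γ₂⁻¹ • P.At) ^ m) *ᵥ v) := by
    rw [smul_pow, Matrix.smul_mulVec, smul_smul, inv_pow, mul_inv_cancel₀ hne, one_smul]
  rw [h, euc_smul (pow_pos hγ₂ m).le]
  refine mul_le_mul_of_nonneg_left ((euc_mulVec_le _ _).trans ?_) (pow_pos hγ₂ m).le
  exact mul_le_mul_of_nonneg_right
    ((le_maxUpTo hm fun m => twoNorm ((γ₂⁻¹ • P.At) ^ m)).trans (le_max_left _ _)) (euc_nonneg _)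

theorem zeta_nonneg (γ₂ : ℝ) (M : ℕ) : 0 ≤ P.zeta γ₂ M :=
  (twoNorm_nonneg _).trans
    ((le_maxUpTo (Nat.zero_le M) fun m => twoNorm ((γ₂⁻¹ • P.At) ^ m)).trans (le_max_left _ _))

/-- The maximum norm of `A` is at most that of `[-Σ Ω -Φ]`. -/
theorem HasGraph.norm_A_mulVec_le {G : SimpleGraph (Fin N)} (hP : P.HasGraph G) (i : Fin N)
    (v : Fin n → ℝ) : ‖P.A *ᵥ v‖ ≤ infNorm P.outRow * ‖v‖ := by
  -- On (0, v, v) the Σ inside Ω cancels against Φ, leaving only I ⊗ A.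
  have h : P.outRow *ᵥ stack 0 (rep N v) (rep N v) = rep N (P.A *ᵥ v) := by
    rw [outRow_mulVec_stack, Matrix.mulVec_zero, neg_zero, zero_add, ← hP.Sig_mulVec_rep, Omg,
      Matrix.add_mulVec, Sig, add_sub_cancel_right, IA, one_kronecker_mulVec_rep]
  have h1 : ‖P.A *ᵥ v‖ ≤ ‖rep N (P.A *ᵥ v)‖ :=
    (pi_norm_le_iff_of_nonneg (norm_nonneg _)).2 fun q =>
      norm_le_pi_norm (rep N (P.A *ᵥ v)) (i, q)
  have h2 : ‖stack (0 : Fin N × Fin n → ℝ) (rep N v) (rep N v)‖ ≤ ‖v‖ := by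
    refine (pi_norm_le_iff_of_nonneg (norm_nonneg _)).2 ?_
    rintro ((p | p) | p)
    · simp [stack]
    · exact norm_le_pi_norm v p.2
    · exact norm_le_pi_norm v p.2
  refine h1.trans ?_
  rw [← h]
  exact (norm_mulVec_le_infNorm _ _).trans (mul_le_mul_of_nonneg_left h2 (infNorm_nonneg _))

/-! ### Consequences of the parameter choice -/

section design

variable {Ψ : Matrix (Fin N) (Fin N) ℂ} {M : ℕ} {d₀ C₄ γ₁ γ₂ : ℝ}

theorem kronecker_one_mem_unitaryGroup (hΨ : P.IsTriangularizer Ψ) :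
    Ψ ⊗ₖ (1 : Matrix (Fin n) (Fin n) ℂ) ∈ Matrix.unitaryGroup (Fin N × Fin n) ℂ :=
  Matrix.kronecker_mem_unitary hΨ.1 (one_mem _)

theorem GoodParams.d₀_pos (h : P.GoodParams Ψ M d₀ C₄ γ₁ γ₂) : 0 < d₀ :=
  lt_of_le_of_lt ENNReal.toReal_nonneg h.rad_lt

theorem GoodParams.γ₁_pos (h : P.GoodParams Ψ M d₀ C₄ γ₁ γ₂) : 0 < γ₁ := h.d₀_pos.trans h.d₀_lt

/-- Unitary conjugation commutes with powers and preserves the norm, so the decay of P̃(1) passes to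
P(1); the exponent 0 is covered by C₄ ≥ 1. -/
theorem GoodParams.twoNorm_Pmat_pow_le (h : P.GoodParams Ψ M d₀ C₄ γ₁ γ₂)
    (hΨ : P.IsTriangularizer Ψ) (k : ℕ) : twoNorm (P.Pmat γ₂ 0 ^ k) ≤ C₄ * d₀ ^ k := by
  rcases Nat.eq_zero_or_pos k with rfl | hk
  · refine twoNorm_le_of_euc_le (by simpa using zero_le_one.trans h.one_le) fun v => ?_
    simpa using le_mul_of_one_le_left (euc_nonneg v) h.one_le
  · refine (twoNorm_le_twoNorm_ofReal _).trans ?_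
    have hU := kronecker_one_mem_unitaryGroup hΨ
    have hd := h.decay k hk
    rw [Pt, unitary_conj_pow hU, twoNorm_unitary_conj hU] at hd
    refine le_of_eq_of_le (congrArg twoNorm ?_) hd
    exact map_pow (Complex.ofRealHom.mapMatrix) (P.Pmat γ₂ 0) k

theorem GoodParams.twoNorm_Pmat_le (h : P.GoodParams Ψ M d₀ C₄ γ₁ γ₂)
    (hΨ : P.IsTriangularizer Ψ) {m : ℕ} (h1 : 1 ≤ m) (hm : m ≤ M) :
    C₄ * twoNorm (P.Pmat γ₂ m) ≤ d₀ := by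
  have hC : 0 < C₄ := zero_lt_one.trans_le h.one_le
  have hs := h.small m h1 hm
  rw [Pt, twoNorm_unitary_conj (kronecker_one_mem_unitaryGroup hΨ), le_div_iff₀ hC] at hs
  have := mul_le_mul_of_nonneg_left (twoNorm_le_twoNorm_ofReal (P.Pmat γ₂ m)) hC.le
  linarith [h.rad_lt]

/-- For m = 0 the exponent shifts. For m ≥ 1 restarting the decay from a plain norm bound costs C₄,
which is paid by C₄ ‖P(m+1)‖ ≤ d₀. -/
theorem GoodParams.decayBound_Pmat_mulVec (h : P.GoodParams Ψ M d₀ C₄ γ₁ γ₂)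
    (hΨ : P.IsTriangularizer Ψ) {m : ℕ} (hm : m ≤ M) {c : ℝ} (hc : 0 ≤ c) {d : Fin N × Fin n → ℝ}
    (hd : DecayBound (P.Pmat γ₂ 0) d₀ c d) :
    DecayBound (P.Pmat γ₂ 0) d₀ (d₀ * c) (P.Pmat γ₂ m *ᵥ d) := by
  have hC : 0 < C₄ := zero_lt_one.trans_le h.one_le
  rcases Nat.eq_zero_or_pos m with rfl | hpos
  · exact hd.mulVec
  · refine (DecayBound.of_euc_le h.d₀_pos.le hC.le (h.twoNorm_Pmat_pow_le hΨ)
      ((euc_mulVec_le _ _).trans (mul_le_mul_of_nonneg_left hd.euc_le (twoNorm_nonneg _)))).mono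
        h.d₀_pos.le ?_
    rw [← mul_assoc]
    exact mul_le_mul_of_nonneg_right (h.twoNorm_Pmat_le hΨ hpos hm) hc

theorem euc_noise_le {m : ℕ} (hm : m ≤ M) {c : ℝ} {e f : Fin N × Fin n → ℝ}
    (he : euc e ≤ c) (hf : euc f ≤ c) :
    euc (P.Smat γ₂ m *ᵥ e + P.Zmat γ₂ m *ᵥ f) ≤ P.C2 γ₂ M * c := by
  have hS := le_maxUpTo hm fun m => twoNorm (P.Smat γ₂ m)
  have hZ := le_maxUpTo hm fun m => twoNorm (P.Zmat γ₂ m)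
  refine (euc_add_le _ _).trans ?_
  rw [C2, add_mul]
  exact add_le_add
    ((euc_mulVec_le _ _).trans (mul_le_mul hS he (euc_nonneg _) ((twoNorm_nonneg _).trans hS)))
    ((euc_mulVec_le _ _).trans (mul_le_mul hZ hf (euc_nonneg _) ((twoNorm_nonneg _).trans hZ)))

theorem GoodParams.C3_nonneg (h : P.GoodParams Ψ M d₀ C₄ γ₁ γ₂) : 0 ≤ P.C3 γ₁ γ₂ M d₀ C₄ := by
  have := zero_le_one.trans h.one_le
  exact le_max_of_le_left (by positivity)

/-- The second entry of the maximum in `C3` is chosen for this: (1 - d₀/γ₁) γ₁ = γ₁ - d₀. -/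
theorem GoodParams.C3_contraction (h : P.GoodParams Ψ M d₀ C₄ γ₁ γ₂) :
    d₀ * P.C3 γ₁ γ₂ M d₀ C₄ + C₄ * (P.C2 γ₂ M * √(N * n)) ≤ P.C3 γ₁ γ₂ M d₀ C₄ * γ₁ := by
  have hγ := h.γ₁_pos
  have e : (1 - d₀ / γ₁) * γ₁ = γ₁ - d₀ := by field_simp
  have h2 : P.C2 γ₂ M * C₄ * √(N * n) / ((1 - d₀ / γ₁) * γ₁) ≤ P.C3 γ₁ γ₂ M d₀ C₄ :=
    le_max_right _ _
  rw [e, div_le_iff₀ (sub_pos.2 h.d₀_lt)] at h2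
  linarith

end design

end System

/-! ### Closed-loop dynamics and scaling -/

namespace System

variable {N n w : ℕ} {P : System N n w}

theorem quantArg_norm_le {y yh : Fin n → ℝ} {t b : ℝ} (ht : 0 < t)
    (h : ‖y - P.A *ᵥ yh‖ ≤ b * t) : ‖P.quantArg y yh t‖ ≤ b := by
  rw [quantArg, norm_smul, norm_inv, Real.norm_of_nonneg ht.le, inv_mul_le_iff₀ ht]
  linarith

theorem abs_sub_quantized_le {R : ℕ} {σ t : ℝ} (hσ : 0 < σ) (ht : 0 < t) {y yh : Fin n → ℝ}
    (h : ‖P.quantArg y yh t‖ ≤ (2 * R + 1) * σ) (p : Fin n) :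
    |y p - (P.A *ᵥ yh + t • quantVec R σ (P.quantArg y yh t)) p| ≤ σ * t := by
  have h1 := abs_sub_quant_le hσ ((norm_le_pi_norm (P.quantArg y yh t) p).trans h)
  have h2 : y p - (P.A *ᵥ yh + t • quantVec R σ (P.quantArg y yh t)) p =
      t * (P.quantArg y yh t p - quant R σ (P.quantArg y yh t p)) := by
    have : t * P.quantArg y yh t p = y p - (P.A *ᵥ yh) p := by
      simp only [quantArg, Pi.smul_apply, Pi.sub_apply, smul_eq_mul]
      field_simp
    rw [mul_sub, this]
    simp only [quantVec, Pi.add_apply, Pi.smul_apply, smul_eq_mul]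
    ring
  rw [h2, abs_mul, abs_of_pos ht, mul_comm]
  exact mul_le_mul_of_nonneg_right h1 ht.le

/-- The stacked differences between the states of the followers and of the leader. -/
def disagreement (y : Fin N → Fin n → ℝ) (y0 : Fin n → ℝ) : Fin N × Fin n → ℝ :=
  stackSub y fun _ => y0

/-- The stacked state of the closed loop that is formed by the disagreement and the estimation
errors. -/
def loopState (y yh : Fin N → Fin n → ℝ) (y0 yh0 : Fin n → ℝ) :
    ((Fin N × Fin n) ⊕ (Fin N × Fin n)) ⊕ (Fin N × Fin n) → ℝ :=
  stack (disagreement y y0) (stackSub y yh) (rep N (y0 - yh0))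

theorem HasGraph.Sig_mulVec_disagreement {G : SimpleGraph (Fin N)} (hP : P.HasGraph G)
    (y yh : Fin N → Fin n → ℝ) (y0 yh0 : Fin n → ℝ) :
    P.Sig *ᵥ disagreement yh yh0 =
      P.Sig *ᵥ disagreement y y0 - P.Sig *ᵥ stackSub y yh + P.Phi *ᵥ rep N (y0 - yh0) := by
  rw [← hP.Sig_mulVec_rep, ← Matrix.mulVec_sub, ← Matrix.mulVec_add]
  congr 1
  ext p
  simp only [disagreement, stackSub, rep, Pi.add_apply, Pi.sub_apply]
  ring

theorem IA_mulVec_stackSub (y y' : Fin N → Fin n → ℝ) (p : Fin N × Fin n) :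
    (P.IA *ᵥ stackSub y y') p = (P.A *ᵥ y p.1) p.2 - (P.A *ᵥ y' p.1) p.2 := by
  rw [IA, one_kronecker_mulVec_apply, ← Pi.sub_apply, ← Matrix.mulVec_sub]
  rfl

namespace IsTrajectory

variable {Δ : ℝ} {S : DoS Δ} {R : ℕ} {σ γ₁ γ₂ θ₀ : ℝ} {x xh : ℕ → Fin N → Fin n → ℝ}
  {x0 xh0 : ℕ → Fin n → ℝ} {θ : ℕ → ℝ} {G : SimpleGraph (Fin N)}

theorem disagreement_succ (h : P.IsTrajectory S R σ γ₁ γ₂ θ₀ x xh x0 xh0 θ) (hP : P.HasGraph G)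
    (k : ℕ) :
    disagreement (x (k + 1)) (x0 (k + 1)) = P.Pim *ᵥ disagreement (x k) (x0 k) +
      P.Sig *ᵥ stackSub (x k) (xh k) - P.Phi *ᵥ rep N (x0 k - xh0 k) := by
  ext p
  have h1 := hP.B_mulVec_input (xh k) (xh0 k) p
  have h2 := congrFun (hP.Sig_mulVec_disagreement (x k) (xh k) (x0 k) (xh0 k)) p
  have h3 := IA_mulVec_stackSub (P := P) (x k) (fun _ => x0 k) p
  have h4 : P.Pim = P.IA - P.Sig := rfl
  rw [h4, Matrix.sub_mulVec]
  simp only [disagreement, Pi.add_apply, Pi.sub_apply] at h2 h3 ⊢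
  rw [h3]
  simp only [stackSub, h.follower, h.leader, Pi.add_apply] at h1 h2 ⊢
  rw [h1]
  linarith

/-- This prediction error is both the unscaled quantizer argument and, if the transmission fails,
the next estimation error; hence `outRow` is the second block row of `At`. -/
theorem follower_sub (h : P.IsTrajectory S R σ γ₁ γ₂ θ₀ x xh x0 xh0 θ) (hP : P.HasGraph G)
    (k : ℕ) (p : Fin N × Fin n) :
    x (k + 1) p.1 p.2 - (P.A *ᵥ xh k p.1) p.2 =
      (P.outRow *ᵥ loopState (x k) (xh k) (x0 k) (xh0 k)) p := by
  have h1 := hP.B_mulVec_input (xh k) (xh0 k) p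
  have h2 := congrFun (hP.Sig_mulVec_disagreement (x k) (xh k) (x0 k) (xh0 k)) p
  have h3 := IA_mulVec_stackSub (P := P) (x k) (xh k) p
  have h4 : P.Omg = P.IA + P.Sig := rfl
  rw [loopState, outRow_mulVec_stack, h4, Matrix.add_mulVec]
  simp only [Pi.add_apply, Pi.sub_apply, Pi.neg_apply] at h2 ⊢
  rw [h3, h.follower, Pi.add_apply, h1]
  simp only [disagreement] at h2 ⊢
  linarith

theorem leader_sub (h : P.IsTrajectory S R σ γ₁ γ₂ θ₀ x xh x0 xh0 θ) (k : ℕ) :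
    x0 (k + 1) - P.A *ᵥ xh0 k = P.A *ᵥ (x0 k - xh0 k) := by
  rw [h.leader, Matrix.mulVec_sub]

theorem loopState_succ_of_fails (h : P.IsTrajectory S R σ γ₁ γ₂ θ₀ x xh x0 xh0 θ)
    (hP : P.HasGraph G) {k : ℕ} (hf : S.Fails (k + 1)) :
    loopState (x (k + 1)) (xh (k + 1)) (x0 (k + 1)) (xh0 (k + 1)) =
      P.At *ᵥ loopState (x k) (xh k) (x0 k) (xh0 k) := by
  have he : stackSub (x (k + 1)) (xh (k + 1)) =
      P.outRow *ᵥ loopState (x k) (xh k) (x0 k) (xh0 k) := by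
    ext p
    rw [← h.follower_sub hP, stackSub, h.est_fail k p.1 hf]
  rw [loopState, loopState, At_mulVec_stack, ← outRow_mulVec_stack, ← h.disagreement_succ hP, IA,
    one_kronecker_mulVec_rep, ← h.leader_sub, he, h.est0_fail k hf]
  rfl

theorem loopState_add (h : P.IsTrajectory S R σ γ₁ γ₂ θ₀ x xh x0 xh0 θ)
    (hP : P.HasGraph G) {s m : ℕ} (hf : ∀ j, 1 ≤ j → j ≤ m → S.Fails (s + j)) :
    loopState (x (s + m)) (xh (s + m)) (x0 (s + m)) (xh0 (s + m)) =
      (P.At ^ m) *ᵥ loopState (x s) (xh s) (x0 s) (xh0 s) := by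
  induction m with
  | zero => simp
  | succ m ih =>
    rw [pow_succ', ← Matrix.mulVec_mulVec, ← ih fun j h1 h2 => hf j h1 (h2.trans m.le_succ)]
    exact h.loopState_succ_of_fails hP (hf (m + 1) (by omega) le_rfl)

theorem leader_error_add (h : P.IsTrajectory S R σ γ₁ γ₂ θ₀ x xh x0 xh0 θ)
    {s m : ℕ} (hf : ∀ j, 1 ≤ j → j ≤ m → S.Fails (s + j)) :
    x0 (s + m) - xh0 (s + m) = (P.A ^ m) *ᵥ (x0 s - xh0 s) := by
  induction m with
  | zero => simp
  | succ m ih =>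
    rw [pow_succ', ← Matrix.mulVec_mulVec, ← ih fun j h1 h2 => hf j h1 (h2.trans m.le_succ),
      ← add_assoc, h.est0_fail (s + m) (hf (m + 1) (by omega) le_rfl), h.leader_sub]

theorem scale_add (h : P.IsTrajectory S R σ γ₁ γ₂ θ₀ x xh x0 xh0 θ)
    {s m : ℕ} (hf : ∀ j, 1 ≤ j → j ≤ m → S.Fails (s + j)) : θ (s + m) = γ₂ ^ m * θ s := by
  induction m with
  | zero => simp
  | succ m ih =>
    rw [← add_assoc, h.scale_fail (s + m) (hf (m + 1) (by omega) le_rfl),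
      ih fun j h1 h2 => hf j h1 (h2.trans m.le_succ)]
    ring

theorem scale_pos (h : P.IsTrajectory S R σ γ₁ γ₂ θ₀ x xh x0 xh0 θ) (hγ₁ : 0 < γ₁) (hγ₂ : 0 < γ₂)
    (hθ₀ : 0 < θ₀) (k : ℕ) : 0 < θ k := by
  induction k with
  | zero => rwa [h.scale_init]
  | succ k ih =>
    by_cases hf : S.Fails (k + 1)
    · rw [h.scale_fail k hf]; positivity
    · rw [h.scale_success k hf]; positivity

theorem scale_eq (h : P.IsTrajectory S R σ γ₁ γ₂ θ₀ x xh x0 xh0 θ) (hγ₁ : 0 < γ₁) (hγ₂ : 0 < γ₂)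
    (k : ℕ) : θ k =
      θ₀ * Real.exp (k * Real.log γ₁ + S.failCount k * (Real.log γ₂ - Real.log γ₁)) := by
  induction k with
  | zero => simp [h.scale_init, DoS.failCount]
  | succ k ih =>
    by_cases hf : S.Fails (k + 1)
    · rw [h.scale_fail k hf, ih, DoS.failCount_succ_of_fails hf]
      conv_lhs => rw [← Real.exp_log hγ₂]
      rw [mul_left_comm, ← Real.exp_add, Real.exp_log hγ₂]
      congr 2
      push_cast
      ring
    · rw [h.scale_success k hf, ih, DoS.failCount_succ_of_not_fails hf]
      conv_lhs => rw [← Real.exp_log hγ₁]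
      rw [mul_left_comm, ← Real.exp_add, Real.exp_log hγ₁]
      congr 2
      push_cast
      ring

theorem scale_tendsto_zero (h : P.IsTrajectory S R σ γ₁ γ₂ θ₀ x xh x0 xh0 θ) (hγ₁ : 0 < γ₁)
    (hγ₁' : γ₁ < 1) (hγ₂ : 0 < γ₂) (hθ₀ : 0 < θ₀) {η τD κ T : ℝ} (hΔ : 0 < Δ) (hτD : 0 < τD)
    (hT : 0 < T) (hfreq : S.FrequencyBound η τD) (hdur : S.DurationBound κ T)
    (hlog : 1 / T + Δ / τD < -Real.log γ₁ / (Real.log γ₂ - Real.log γ₁)) :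
    Tendsto θ atTop (𝓝 0) := by
  have hρ : 0 < 1 / T + Δ / τD := by positivity
  have hneg : Real.log γ₁ < 0 := Real.log_neg hγ₁ hγ₁'
  -- The assumed bound forces γ₂ > γ₁: otherwise its right side is nonpositive, being 0 by
  -- convention when the denominator vanishes.
  have hL : 0 < Real.log γ₂ - Real.log γ₁ := by
    by_contra! hcon
    exact (hρ.trans hlog).not_ge (div_nonpos_of_nonneg_of_nonpos (by linarith) hcon)
  rw [lt_div_iff₀ hL] at hlog
  set ℓ := Real.log γ₂ - Real.log γ₁
  set ρ := 1 / T + Δ / τD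
  -- The exponent of θ with the failure count replaced by its bound κ/Δ + η + kρ; its slope in k is
  -- negative by `hlog`.
  have hlim : Tendsto (fun k : ℕ => θ₀ * Real.exp ((κ / Δ + η) * ℓ +
      (Real.log γ₁ + ρ * ℓ) * k)) atTop (𝓝 (θ₀ * 0)) := by
    refine (Real.tendsto_exp_atBot.comp ?_).const_mul θ₀
    refine tendsto_atBot_add_const_left _ _ ?_
    exact tendsto_natCast_atTop_atTop.const_mul_atTop_of_neg (by linarith)
  rw [mul_zero] at hlim
  refine squeeze_zero' (Eventually.of_forall fun k => (h.scale_pos hγ₁ hγ₂ hθ₀ k).le) ?_ hlim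
  filter_upwards [eventually_ge_atTop 1] with k hk
  rw [h.scale_eq hγ₁ hγ₂ k]
  refine mul_le_mul_of_nonneg_left (Real.exp_le_exp.2 ?_) hθ₀.le
  have hF := DoS.failCount_mul_le hΔ hτD hfreq hdur hk
  have hF' : (S.failCount k : ℝ) ≤ κ / Δ + η + k * ρ := by
    rw [← mul_le_mul_iff_left₀ hΔ]
    change _ ≤ κ + η * Δ + k * Δ * ρ at hF
    refine hF.trans_eq ?_
    field_simp
  nlinarith

/-- The bounds on the disagreement and on the estimation errors, relative to the scaling
parameter, that hold after a successful transmission. -/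
structure Reset (P : System N n w) (d₀ γ₂ C c : ℝ) (y yh : Fin N → Fin n → ℝ)
    (y0 yh0 : Fin n → ℝ) : Prop where
  decay : DecayBound (P.Pmat γ₂ 0) d₀ (C * c) (disagreement y y0)
  follower : ∀ i q, |y i q - yh i q| ≤ c
  leader : ∀ q, |y0 q - yh0 q| ≤ c

namespace Reset

variable {d₀ C c : ℝ} {y yh : Fin N → Fin n → ℝ} {y0 yh0 : Fin n → ℝ}

theorem euc_stackSub_le (h : Reset P d₀ γ₂ C c y yh y0 yh0) (hc : 0 ≤ c) :
    euc (stackSub y yh) ≤ √(N * n) * c := by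
  simpa using euc_le_sqrt_card_mul (v := stackSub y yh) hc fun p => h.follower p.1 p.2

theorem euc_rep_le (h : Reset P d₀ γ₂ C c y yh y0 yh0) (hc : 0 ≤ c) :
    euc (rep N (y0 - yh0)) ≤ √(N * n) * c := by
  simpa using euc_le_sqrt_card_mul (v := rep N (y0 - yh0)) hc fun p => h.leader p.2

theorem euc_loopState_le (h : Reset P d₀ γ₂ C c y yh y0 yh0) (hc : 0 ≤ c) :
    euc (loopState y yh y0 yh0) ≤ √(C ^ 2 + 2 * N * n) * c := by
  refine le_of_sq_le_sq ?_ (by positivity)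
  have h1 := pow_le_pow_left₀ (euc_nonneg _) h.decay.euc_le 2
  have h2 := pow_le_pow_left₀ (euc_nonneg _) (h.euc_stackSub_le hc) 2
  have h3 := pow_le_pow_left₀ (euc_nonneg _) (h.euc_rep_le hc) 2
  rw [mul_pow, Real.sq_sqrt (by positivity)] at h2 h3 ⊢
  rw [loopState, stack, euc_elim_sq, euc_elim_sq]
  linarith

end Reset

/-! ### The invariant at successful transmissions -/

section invariant

variable {Ψ : Matrix (Fin N) (Fin N) ℂ} {M : ℕ} {d₀ C₄ : ℝ}

/-- Time 0 acts as a success: the lower bound on θ₀ makes the initial states at most (σ/γ₁) θ₀. The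
disagreement is at most twice that, which accounts for the first entry of `C3`. -/
theorem reset_zero (h : P.IsTrajectory S R σ γ₁ γ₂ θ₀ x xh x0 xh0 θ)
    (hpar : P.GoodParams Ψ M d₀ C₄ γ₁ γ₂) (hΨ : P.IsTriangularizer Ψ) (hσ : 0 < σ) {Cx0 : ℝ}
    (hCx0 : 0 < Cx0) (hθ₀ : Cx0 * γ₁ / σ ≤ θ₀) (hx : ∀ i, ‖x 0 i‖ ≤ Cx0) (hx0 : ‖x0 0‖ ≤ Cx0) :
    Reset P d₀ γ₂ (P.C3 γ₁ γ₂ M d₀ C₄) (σ / γ₁ * θ 0) (x 0) (xh 0) (x0 0) (xh0 0) := by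
  have hγ₁ := hpar.γ₁_pos
  have hC : 0 ≤ C₄ := zero_le_one.trans hpar.one_le
  have hle : Cx0 ≤ σ / γ₁ * θ 0 := by
    rw [h.scale_init, div_mul_eq_mul_div, le_div_iff₀ hγ₁, mul_comm σ]
    exact (div_le_iff₀ hσ).1 hθ₀
  have hc : 0 ≤ σ / γ₁ * θ 0 := hCx0.le.trans hle
  have hf : ∀ i q, |x 0 i q| ≤ σ / γ₁ * θ 0 := fun i q =>
    ((norm_le_pi_norm (x 0 i) q).trans (hx i)).trans hle
  have hl : ∀ q, |x0 0 q| ≤ σ / γ₁ * θ 0 := fun q =>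
    ((norm_le_pi_norm (x0 0) q).trans hx0).trans hle
  refine ⟨?_, fun i q => by simpa [h.est_init] using hf i q,
    fun q => by simpa [h.est0_init] using hl q⟩
  have he : euc (disagreement (x 0) (x0 0)) ≤ √(N * n) * (2 * (σ / γ₁ * θ 0)) := by
    simpa using euc_le_sqrt_card_mul (v := disagreement (x 0) (x0 0)) (by positivity) fun p =>
      (abs_sub _ _).trans ((add_le_add (hf p.1 p.2) (hl p.2)).trans_eq (two_mul _).symm)
  refine (DecayBound.of_euc_le hpar.d₀_pos.le hC (hpar.twoNorm_Pmat_pow_le hΨ) he).mono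
    hpar.d₀_pos.le ?_
  have h3 : 2 * C₄ * √(N * n) ≤ P.C3 γ₁ γ₂ M d₀ C₄ := le_max_left _ _
  exact le_of_eq_of_le (by ring) (mul_le_mul_of_nonneg_right h3 hc)

/-- State and θ evolve by `At`^m and γ₂^m, so their ratio grows by at most ‖(At/γ₂)^m‖ ≤ ζ. -/
theorem euc_loopState_add_le (h : P.IsTrajectory S R σ γ₁ γ₂ θ₀ x xh x0 xh0 θ)
    (hP : P.HasGraph G) (hγ₁ : 0 < γ₁) (hγ₂ : 0 < γ₂) (hσ : 0 < σ) {C : ℝ} {s m : ℕ}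
    (hm : m ≤ M) (hs : 0 < θ s)
    (hr : Reset P d₀ γ₂ C (σ / γ₁ * θ s) (x s) (xh s) (x0 s) (xh0 s))
    (hf : ∀ j, 1 ≤ j → j ≤ m → S.Fails (s + j)) :
    euc (loopState (x (s + m)) (xh (s + m)) (x0 (s + m)) (xh0 (s + m))) ≤
      P.zeta γ₂ M * √(C ^ 2 + 2 * N * n) / γ₁ * σ * θ (s + m) := by
  rw [h.loopState_add hP hf, h.scale_add hf]
  refine (euc_At_pow_mulVec_le hγ₂ hm _).trans ?_
  refine (mul_le_mul_of_nonneg_left (mul_le_mul_of_nonneg_left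
    (hr.euc_loopState_le (by positivity)) (zeta_nonneg _ _)) (pow_pos hγ₂ m).le).trans_eq ?_
  ring

/-- If the stacked state is small compared with the scaling parameter, then no quantizer is
overflowed in the next transmission attempt. -/
theorem no_overflow_of_euc_le (h : P.IsTrajectory S R σ γ₁ γ₂ θ₀ x xh x0 xh0 θ)
    (hP : P.HasGraph G) (hN : Nonempty (Fin N)) (hσ : 0 < σ) {C : ℝ} {k : ℕ} (hk : 0 < θ k)
    (hlevels : P.zeta γ₂ M * infNorm P.outRow * √(C ^ 2 + 2 * N * n) / γ₁ ≤ 2 * R + 1)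
    (he : euc (loopState (x k) (xh k) (x0 k) (xh0 k)) ≤
      P.zeta γ₂ M * √(C ^ 2 + 2 * N * n) / γ₁ * σ * θ k) :
    (∀ i, ‖P.quantArg (x (k + 1) i) (xh k i) (θ k)‖ ≤ (2 * R + 1) * σ) ∧
      ‖P.quantArg (x0 (k + 1)) (xh0 k) (θ k)‖ ≤ (2 * R + 1) * σ := by
  set z := loopState (x k) (xh k) (x0 k) (xh0 k) with hz
  have hb : infNorm P.outRow * ‖z‖ ≤ (2 * R + 1) * σ * θ k := by
    refine (mul_le_mul_of_nonneg_left ((norm_le_euc z).trans he) (infNorm_nonneg _)).trans ?_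
    refine le_of_eq_of_le ?_ (mul_le_mul_of_nonneg_right hlevels (mul_pos hσ hk).le |>.trans_eq
      (mul_assoc _ _ _).symm)
    ring
  constructor
  · intro i
    refine quantArg_norm_le hk (le_trans ?_ hb)
    refine le_trans ?_ (norm_mulVec_le_infNorm P.outRow z)
    refine (pi_norm_le_iff_of_nonneg (norm_nonneg _)).2 fun q => ?_
    rw [Pi.sub_apply, h.follower_sub hP k (i, q)]
    exact norm_le_pi_norm _ _
  -- The leader's error occurs in `z` only as copies indexed by followers, so one follower is
  -- needed.
  · obtain ⟨i⟩ := hN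
    refine quantArg_norm_le hk (le_trans ?_ hb)
    rw [h.leader_sub]
    refine (hP.norm_A_mulVec_le i _).trans (mul_le_mul_of_nonneg_left ?_ (infNorm_nonneg _))
    exact (pi_norm_le_iff_of_nonneg (norm_nonneg _)).2 fun q => norm_le_pi_norm z (Sum.inr (i, q))

theorem reset_succ (h : P.IsTrajectory S R σ γ₁ γ₂ θ₀ x xh x0 xh0 θ) (hP : P.HasGraph G)
    (hpar : P.GoodParams Ψ M d₀ C₄ γ₁ γ₂) (hΨ : P.IsTriangularizer Ψ) (hσ : 0 < σ) {s m : ℕ}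
    (hm : m ≤ M) (hs : 0 < θ s)
    (hr : Reset P d₀ γ₂ (P.C3 γ₁ γ₂ M d₀ C₄) (σ / γ₁ * θ s) (x s) (xh s) (x0 s) (xh0 s))
    (hf : ∀ j, 1 ≤ j → j ≤ m → S.Fails (s + j)) (hsucc : ¬ S.Fails (s + m + 1))
    (hq : (∀ i, ‖P.quantArg (x (s + m + 1) i) (xh (s + m) i) (θ (s + m))‖ ≤ (2 * R + 1) * σ) ∧
      ‖P.quantArg (x0 (s + m + 1)) (xh0 (s + m)) (θ (s + m))‖ ≤ (2 * R + 1) * σ) :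
    Reset P d₀ γ₂ (P.C3 γ₁ γ₂ M d₀ C₄) (σ / γ₁ * θ (s + m + 1)) (x (s + m + 1)) (xh (s + m + 1))
      (x0 (s + m + 1)) (xh0 (s + m + 1)) := by
  have hγ₁ := hpar.γ₁_pos
  have hγ₂ := hpar.γ₂_pos
  have hC : 0 ≤ C₄ := zero_le_one.trans hpar.one_le
  have hθ : 0 < θ (s + m) := by rw [h.scale_add hf]; positivity
  -- The quantization error is relative to the old θ; the 1/γ₁ in the invariant compensates for the
  -- zoom-in.
  have hσθ : σ / γ₁ * θ (s + m + 1) = σ * θ (s + m) := by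
    rw [h.scale_success _ hsucc]; field_simp
  have hc : 0 ≤ σ / γ₁ * θ s := by positivity
  refine ⟨?_, fun i q => ?_, fun q => ?_⟩
  · have hstep := disagreement_after hγ₂ m (h.loopState_add hP hf)
      (by rw [h.leader_error_add hf, one_kronecker_mulVec_rep])
    rw [h.disagreement_succ hP, hstep]
    have hnoise := euc_noise_le (P := P) (γ₂ := γ₂) hm (hr.euc_stackSub_le hc) (hr.euc_rep_le hc)
    have hdec := ((hpar.decayBound_Pmat_mulVec hΨ hm (mul_nonneg hpar.C3_nonneg hc) hr.decay).add
      (DecayBound.of_euc_le hpar.d₀_pos.le hC (hpar.twoNorm_Pmat_pow_le hΨ) hnoise)).smul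
        (pow_pos hγ₂ m).le
    refine hdec.mono hpar.d₀_pos.le ?_
    rw [h.scale_success _ hsucc, h.scale_add hf]
    have := mul_le_mul_of_nonneg_left hpar.C3_contraction
      (mul_nonneg (pow_pos hγ₂ m).le hc)
    linarith
  · rw [hσθ, h.est_success _ i hsucc]
    exact abs_sub_quantized_le hσ hθ (hq.1 i) q
  · rw [hσθ, h.est0_success _ hsucc]
    exact abs_sub_quantized_le hσ hθ hq.2 q

end invariant

end IsTrajectory

end System

end LeaderFollower

end

/-! ### Assembling the theorem -/

open LeaderFollower in
theorem theorem2 {N n w : ℕ} (P : System N n w)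
    -- the communication graph
    (G : SimpleGraph (Fin N)) (hG : G.Connected) (hP : P.HasGraph G)
    -- sampling and DoS attacks
    (Δ : ℝ) (hΔ : 0 < Δ) (S : DoS Δ)
    (η τD κ T : ℝ) (hη : 0 ≤ η) (hτD : 0 < τD) (hκ : 0 ≤ κ) (hT : 1 < T)
    (hfreq : S.FrequencyBound η τD) (hdur : S.DurationBound κ T)
    (hDoS : 1 / T + Δ / τD < 1)
    -- the quantizer and the initial states
    (R : ℕ) (hR : 0 < R) (σ : ℝ) (hσ : 0 < σ) (Cx0 : ℝ) (hCx0 : 0 < Cx0)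
    -- the design parameters
    (Ψ : Matrix (Fin N) (Fin N) ℂ) (hΨ : P.IsTriangularizer Ψ)
    (d₀ C₄ γ₁ γ₂ θ₀ : ℝ)
    (hpar : P.GoodParams Ψ (maxFail Δ η τD κ T) d₀ C₄ γ₁ γ₂)
    (hθ₀ : Cx0 * γ₁ / σ ≤ θ₀)
    (hlevels : P.zeta γ₂ (maxFail Δ η τD κ T) * infNorm P.outRow *
      √(P.C3 γ₁ γ₂ (maxFail Δ η τD κ T) d₀ C₄ ^ 2 + 2 * N * n) / γ₁ ≤ 2 * R + 1)
    -- the closed loop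
    (x xh : ℕ → Fin N → Fin n → ℝ) (x0 xh0 : ℕ → Fin n → ℝ) (θ : ℕ → ℝ)
    (htraj : P.IsTrajectory S R σ γ₁ γ₂ θ₀ x xh x0 xh0 θ)
    (hx : ∀ i, ‖x 0 i‖ ≤ Cx0) (hx0 : ‖x0 0‖ ≤ Cx0) :
    P.NoOverflow R σ x xh x0 xh0 θ ∧
    (1 / T + Δ / τD < -Real.log γ₁ / (Real.log γ₂ - Real.log γ₁) →
      ∀ i, Tendsto (fun k => ‖x k i - x0 k‖) atTop (𝓝 0)) := by
  have hγ₁ := hpar.γ₁_pos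
  have hγ₂ := hpar.γ₂_pos
  have hθ₀' : 0 < θ₀ := lt_of_lt_of_le (by positivity) hθ₀
  have hθ := htraj.scale_pos hγ₁ hγ₂ hθ₀'
  -- Here `s` is the last success up to `k`, or 0 if there is none, and `m` counts the failures
  -- since.
  have hmain : ∀ k, ∃ s m, k = s + m ∧ (s = 0 ∨ ¬ S.Fails s) ∧
      (∀ j, 1 ≤ j → j ≤ m → S.Fails (s + j)) ∧
      System.IsTrajectory.Reset P d₀ γ₂ (P.C3 γ₁ γ₂ (maxFail Δ η τD κ T) d₀ C₄) (σ / γ₁ * θ s)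
        (x s) (xh s) (x0 s) (xh0 s) := by
    intro k
    induction k with
    | zero => exact ⟨0, 0, rfl, Or.inl rfl, by omega,
        htraj.reset_zero hpar hΨ hσ hCx0 hθ₀ hx hx0⟩
    | succ k ih =>
      obtain ⟨s, m, rfl, hs, hf, hr⟩ := ih
      by_cases hfail : S.Fails (s + m + 1)
      · refine ⟨s, m + 1, rfl, hs, fun j h1 h2 => ?_, hr⟩
        rcases h2.lt_or_eq with h2 | rfl
        · exact hf j h1 (Nat.le_of_lt_succ h2)
        · exact hfail
      -- The old reset excludes overflow at this attempt, which is what the new reset requires.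
      · have hm := DoS.consecutive_fails_le hΔ hτD hfreq hdur hDoS hs hf
        exact ⟨s + m + 1, 0, rfl, Or.inr hfail, by omega,
          htraj.reset_succ hP hpar hΨ hσ hm (hθ s) hr hf hfail
            (htraj.no_overflow_of_euc_le hP hG.nonempty hσ (hθ _) hlevels
              (htraj.euc_loopState_add_le hP hγ₁ hγ₂ hσ hm (hθ s) hr hf))⟩
  have hbound : ∀ k, euc (System.loopState (x k) (xh k) (x0 k) (xh0 k)) ≤
      P.zeta γ₂ (maxFail Δ η τD κ T) *
        √(P.C3 γ₁ γ₂ (maxFail Δ η τD κ T) d₀ C₄ ^ 2 + 2 * N * n) / γ₁ * σ * θ k := by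
    intro k
    obtain ⟨s, m, rfl, hs, hf, hr⟩ := hmain k
    exact htraj.euc_loopState_add_le hP hγ₁ hγ₂ hσ
      (DoS.consecutive_fails_le hΔ hτD hfreq hdur hDoS hs hf) (hθ s) hr hf
  refine ⟨fun k => htraj.no_overflow_of_euc_le hP hG.nonempty hσ (hθ k) hlevels (hbound k),
    fun hlog i => ?_⟩
  have hlim := (htraj.scale_tendsto_zero hγ₁ hpar.lt_one hγ₂ hθ₀' hΔ hτD (zero_lt_one.trans hT)
    hfreq hdur hlog).const_mul (P.zeta γ₂ (maxFail Δ η τD κ T) *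
      √(P.C3 γ₁ γ₂ (maxFail Δ η τD κ T) d₀ C₄ ^ 2 + 2 * N * n) / γ₁ * σ)
  rw [mul_zero] at hlim
  refine squeeze_zero (fun k => norm_nonneg _) (fun k => le_trans ?_ (hbound k)) hlim
  refine ((pi_norm_le_iff_of_nonneg (norm_nonneg _)).2 fun q => ?_).trans (norm_le_euc _)
  exact norm_le_pi_norm (System.loopState (x k) (xh k) (x0 k) (xh0 k)) (Sum.inl (Sum.inl (i, q)))
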